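/- For integers $\Delta,k,\ell$ let $T_\ell$ be the complete rooted tree of depth $\ell$ in which every non-leaf vertex has $\Delta$ children, let $L$ be its set of leaves, and let $\mu_\ell$ be the uniform measure on the proper $k$-colorings of $T_\ell$ (with color set $[k]=\{1,\dots,k\}$). There are functions $\alpha,\Delta_0,\ell_0$ of a real variable such that the following holds for every real $C>1$, with $\varepsilon=\min\{C-1,1/3\}$. We have $\alpha(\varepsilon)>0$, and for every integer $\Delta>\Delta_0(\varepsilon)$ and every integer $k>C\Delta/\ln\Delta$: (i) for every color $c\in[k]$ and every depth $\ell>\ell_0(\varepsilon)$, $$\mathbf{E}_{\tau\sim\mu_\ell}\Big[\Big|\mu_\ell\big(\sigma(\mathrm{root})=c\,\big|\,\sigma(L)=\tau(L)\big)-\tfrac1k\Big|\Big]\le\Delta^{-\alpha(\varepsilon)\,\ell};$$ (ii) non-reconstruction holds for $k$-colorings of the $\Delta$-ary tree: for every color $c\in[k]$ the expectation in (i) tends to $0$ as $\ell\to\infty$; (iii) the free-boundary measure for $k$-colorings of the infinite $\Delta$-ary tree, i.e. the limit of the measures $\mu_\ell$ as $\ell\to\infty$ in the sense of convergence of the probabilities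 of all finite-dimensional cylinder events, exists and is unique, and it is an extremal Gibbs measure. Here a Gibbs measure is a probability measure on $[k]^{V}$ ($V$ the vertices of the infinite tree) under which, for every finite $\Lambda\subset V$, the configuration given its values outside $\Lambda$ is uniform over all colorings of $\Lambda$ that are compatible with those values and properly color every edge meeting $\Lambda$; it is extremal if it is not a nontrivial convex combination of other Gibbs measures. -/

import Mathlib

open MeasureTheory ProbabilityTheory Filter Topology
open scoped NNReal ENNReal

noncomputable section

namespace TreeColoring

/-- The infinite rooted tree in which every vertex has exactly `Δ` children. A vertex is the word
of choices leading to it from the root (last choice first): the root is `[]`, the children of `v`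
are the words `a :: v`, and the depth of `v` is `v.length`. -/
def tree (Δ : ℕ) : SimpleGraph (List (Fin Δ)) where
  Adj v w := (∃ a, w = a :: v) ∨ (∃ a, v = a :: w)
  symm := ⟨fun _ _ h => h.symm⟩
  loopless := ⟨fun v h => by
    rcases h with ⟨a, h⟩ | ⟨a, h⟩ <;> simpa using congrArg List.length h⟩

/-- The vertices of depth at most `ℓ`. -/
abbrev ball (Δ ℓ : ℕ) : Set (List (Fin Δ)) := {v | v.length ≤ ℓ}

/-- The complete tree `T_ℓ` with branching factor `Δ` and depth `ℓ`. -/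
abbrev finTree (Δ ℓ : ℕ) : SimpleGraph (ball Δ ℓ) := (tree Δ).induce (ball Δ ℓ)

/-- The root of `T_ℓ`. -/
def root (Δ ℓ : ℕ) : ball Δ ℓ := ⟨[], Nat.zero_le ℓ⟩

/-- The leaves of `T_ℓ`. -/
def leaves (Δ ℓ : ℕ) : Set (ball Δ ℓ) := {v | v.1.length = ℓ}

/-- The proper `k`-colorings of a graph, as functions to `Fin k`. -/
def colorings {V : Type*} (G : SimpleGraph V) (k : ℕ) : Set (V → Fin k) :=
  {σ | ∀ v w, G.Adj v w → σ v ≠ σ w}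

/-- The uniform measure `μ_ℓ` on the `k`-colorings of `T_ℓ`. -/
def mu (Δ k ℓ : ℕ) : Measure (ball Δ ℓ → Fin k) :=
  uniformOn (colorings (finTree Δ ℓ) k)

/-- The conditional probability `μ_ℓ(σ(root) = c | σ(L) = τ(L))`. -/
def rootMarginal (Δ k ℓ : ℕ) (τ : ball Δ ℓ → Fin k) (c : Fin k) : ℝ :=
  ((mu Δ k ℓ)[|{σ | ∀ v ∈ leaves Δ ℓ, σ v = τ v}]).real {σ | σ (root Δ ℓ) = c}

/-- The expected deviation `E_{τ ∼ μ_ℓ} |μ_ℓ(σ(root) = c | σ(L) = τ(L)) - 1/k|`. -/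
def expectedBias (Δ k ℓ : ℕ) (c : Fin k) : ℝ :=
  ∫ τ, |rootMarginal Δ k ℓ τ c - 1 / (k : ℝ)| ∂(mu Δ k ℓ)

/-- Non-reconstruction: for every color the expected deviation at the root tends to `0`. -/
def NonReconstruction (Δ k : ℕ) : Prop :=
  ∀ c : Fin k, Tendsto (fun ℓ => expectedBias Δ k ℓ c) atTop (𝓝 0)

/-- The configurations that agree with `τ` outside `Λ` and in which every edge of the infinite
tree having an endpoint in `Λ` is properly colored. -/
def extensions (Δ k : ℕ) (Λ : Finset (List (Fin Δ))) (τ : List (Fin Δ) → Fin k) :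
    Set (List (Fin Δ) → Fin k) :=
  {ξ | (∀ v, v ∉ Λ → ξ v = τ v) ∧ ∀ v ∈ Λ, ∀ w, (tree Δ).Adj v w → ξ v ≠ ξ w}

/-- The Gibbs measures for `k`-colorings of the infinite tree: the probability measures for which,
for every finite set `Λ` of vertices, the configuration given its values outside `Λ` is uniform
over the proper colorings of `Λ` compatible with them (the DLR equations). -/
def gibbsMeasures (Δ k : ℕ) : Set (Measure (List (Fin Δ) → Fin k)) :=
  {μ | IsProbabilityMeasure μ ∧
    ∀ (Λ : Finset (List (Fin Δ))) (A : Set (List (Fin Δ) → Fin k)), MeasurableSet A →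
      μ A = ∫⁻ τ, uniformOn (extensions Δ k Λ τ) A ∂μ}

/-- `μ` is the free-boundary measure on configurations of the infinite tree: the limit, as
`ℓ → ∞`, of the uniform measures `μ_ℓ`, in the sense that the probabilities of all
finite-dimensional cylinder events converge. -/
def IsFreeBoundaryMeasure (Δ k : ℕ) (μ : Measure (List (Fin Δ) → Fin k)) : Prop :=
  IsProbabilityMeasure μ ∧
    ∀ (S : Finset (List (Fin Δ))) (η : List (Fin Δ) → Fin k),
      Tendsto (fun ℓ => mu Δ k ℓ {σ | ∀ v : ball Δ ℓ, v.1 ∈ S → σ v = η v.1}) atTop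
        (𝓝 (μ {σ | ∀ v ∈ S, σ v = η v}))

/-- `μ` is an extremal Gibbs measure: a Gibbs measure that is not a nontrivial convex combination
of other Gibbs measures. -/
def IsExtremalGibbs (Δ k : ℕ) (μ : Measure (List (Fin Δ) → Fin k)) : Prop :=
  μ ∈ (gibbsMeasures Δ k).extremePoints ℝ≥0

end TreeColoring

end

/-! A uniform coloring of the tree is a broadcast: every child takes a uniform color different from
its parent's. The information that the leaves at depth `n` carry about the root is measured by the
chi-square divergence `rootInfo` of the channel from root color to leaf coloring, written D_n here.

Crossing an edge turns a density f into (k - f)/(k - 1), so deviations from 1 shrink by k - 1 and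
second moments by (k - 1)^2; independent children multiply second moments. Hence the densities
relative to the product of the averaged child laws have second moment (1 + D_n/(k-1)^2)^Δ. Passing
to the true averaged law costs a factor 4, because color symmetry makes the densities of distinct
root colors nonpositively correlated (`overlap_lik_le_one`). This gives D_{n+1} ≤ 4((1 +
D_n/(k-1)^2)^Δ - 1) (`rootInfo_succ_le`).

From D_0 = k - 1 the first step gives D_1 ≤ 4 exp(Δ/(k-1)) ≤ 4 Δ^s with s < 1; this is where C > 1
enters. Then Δ D_1/(k-1)^2 ≤ 1, the recursion is in its linear regime, and each further step
contracts by 8Δ/(k-1)^2 ≤ Δ^(-1/2) (`eventually_rootInfo_le`). Cauchy–Schwarz turns this into decay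
of the bias (`expectedBias_le`).

On the infinite tree the broadcast law `freeMeasure` has the measures μ_ℓ as exact marginals
(`mu_eq_map`), so it is the free-boundary measure. As D_n → 0, the conditional probability of a
cylinder given a far boundary becomes constant in L¹. If a·μ₁ + b·μ₂ is this law with a > 0, the
same convergence holds in L¹(μ₁), which forces μ₁ to give every cylinder the same probability
(`isExtremalGibbs_freeMeasure`). -/

noncomputable section

namespace TreeColoring

/-! ### The chi-square functional of a channel with `k` inputs -/

section Channel

variable {k : ℕ} {B : Type*} [Fintype B]

/-- The output law of the channel `p` under a uniform input. -/
def avgLik (p : Fin k → B → ℝ) (b : B) : ℝ := (∑ c, p c b) / k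

/-- The inner product of the densities of `p c` and `p c'` with respect to `avgLik p`. -/
def overlap (p : Fin k → B → ℝ) (c c' : Fin k) : ℝ := ∑ b, p c b * p c' b / avgLik p b

/-- The chi-square divergence of the channel, averaged over the input. -/
def chiSq (p : Fin k → B → ℝ) : ℝ := (∑ c, overlap p c c) / k - 1

/-- The channel obtained by moving to a uniform other input independently `d` times and then
applying `p`. -/
def branch (d : ℕ) (p : Fin k → B → ℝ) (c : Fin k) (b : Fin d → B) : ℝ :=
  ∏ i, (∑ c', p c' (b i) - p c (b i)) / ((k : ℝ) - 1)

/-- A channel given by probability weights. -/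
structure IsChannel (p : Fin k → B → ℝ) : Prop where
  nonneg : ∀ c b, 0 ≤ p c b
  sum_eq_one : ∀ c, ∑ b, p c b = 1

lemma IsChannel.avgLik_nonneg {p : Fin k → B → ℝ} (hp : IsChannel p) (b : B) : 0 ≤ avgLik p b :=
  div_nonneg (Finset.sum_nonneg fun c _ => hp.nonneg c b) (Nat.cast_nonneg k)

lemma sum_eq_mul_avgLik {B : Type*} (hk : 2 ≤ k) (p : Fin k → B → ℝ) (b : B) :
    ∑ c, p c b = k * avgLik p b := by
  have : (k : ℝ) ≠ 0 := by positivity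
  rw [avgLik]; field_simp

lemma IsChannel.sum_avgLik (hk : 2 ≤ k) {p : Fin k → B → ℝ} (hp : IsChannel p) :
    ∑ b, avgLik p b = 1 := by
  have : (k : ℝ) ≠ 0 := by positivity
  simp only [avgLik]
  rw [← Finset.sum_div, Finset.sum_comm]
  simp [hp.sum_eq_one, this]

lemma IsChannel.eq_zero_of_avgLik (hk : 2 ≤ k) {p : Fin k → B → ℝ} (hp : IsChannel p) {b : B}
    (hb : avgLik p b = 0) (c : Fin k) : p c b = 0 := by
  have h := sum_eq_mul_avgLik hk p b
  rw [hb, mul_zero, Finset.sum_eq_zero_iff_of_nonneg fun c _ => hp.nonneg c b] at h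
  exact h c (Finset.mem_univ c)

lemma IsChannel.le_sum {p : Fin k → B → ℝ} (hp : IsChannel p) (c : Fin k) (b : B) :
    p c b ≤ ∑ c', p c' b :=
  Finset.single_le_sum (f := fun c' => p c' b) (fun c' _ => hp.nonneg c' b) (Finset.mem_univ c)

lemma IsChannel.branch (hk : 2 ≤ k) (d : ℕ) {p : Fin k → B → ℝ} (hp : IsChannel p) :
    IsChannel (branch d p) where
  nonneg c b := by
    have : (2 : ℝ) ≤ k := by exact_mod_cast hk
    exact Finset.prod_nonneg fun i _ =>
      div_nonneg (sub_nonneg.2 (hp.le_sum c _)) (by linarith)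
  sum_eq_one c := by
    have : (2 : ℝ) ≤ k := by exact_mod_cast hk
    have hne : (k : ℝ) - 1 ≠ 0 := by linarith
    have h := Finset.prod_univ_sum (fun _ : Fin d => (Finset.univ : Finset B))
      (fun _ b => (∑ c', p c' b - p c b) / ((k : ℝ) - 1))
    simp only [Fintype.piFinset_univ] at h
    unfold TreeColoring.branch
    rw [← h]
    apply Finset.prod_eq_one
    intro i _
    rw [← Finset.sum_div, Finset.sum_sub_distrib, Finset.sum_comm]
    simp only [hp.sum_eq_one]
    simp [hne]

/-- The density of `p c` with respect to the average output law. -/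
def density (p : Fin k → B → ℝ) (c : Fin k) (b : B) : ℝ := p c b / avgLik p b

lemma IsChannel.eq_avgLik_mul_density (hk : 2 ≤ k) {p : Fin k → B → ℝ} (hp : IsChannel p)
    (c : Fin k) (b : B) : p c b = avgLik p b * density p c b := by
  unfold density
  by_cases hb : avgLik p b = 0
  · rw [hp.eq_zero_of_avgLik hk hb, hb]; simp
  · field_simp

lemma overlap_eq_sum_density (p : Fin k → B → ℝ) (c c' : Fin k) :
    overlap p c c' = ∑ b, avgLik p b * (density p c b * density p c' b) := by
  refine Finset.sum_congr rfl fun b _ => ?_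
  unfold density
  by_cases hb : avgLik p b = 0
  · rw [hb]; simp
  · field_simp

lemma IsChannel.sum_avgLik_mul_density (hk : 2 ≤ k) {p : Fin k → B → ℝ} (hp : IsChannel p)
    (c : Fin k) : ∑ b, avgLik p b * density p c b = 1 := by
  rw [← hp.sum_eq_one c]
  exact Finset.sum_congr rfl fun b _ => (hp.eq_avgLik_mul_density hk c b).symm

/-- The densities of the k inputs average to 1. Under color symmetry this row sum determines the
off-diagonal overlaps from the diagonal one. -/
lemma IsChannel.sum_overlap (hk : 2 ≤ k) {p : Fin k → B → ℝ} (hp : IsChannel p) (c : Fin k) :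
    ∑ c', overlap p c c' = k := by
  unfold overlap
  rw [Finset.sum_comm]
  have : ∀ b, ∑ c', p c b * p c' b / avgLik p b = k * p c b := by
    intro b
    rw [← Finset.sum_div, ← Finset.mul_sum, sum_eq_mul_avgLik hk p b]
    by_cases hb : avgLik p b = 0
    · rw [hp.eq_zero_of_avgLik hk hb]; simp
    · field_simp
  simp only [this, ← Finset.mul_sum, hp.sum_eq_one, mul_one]

lemma IsChannel.overlap_self_sub_one (hk : 2 ≤ k) {p : Fin k → B → ℝ} (hp : IsChannel p)
    (c : Fin k) : overlap p c c - 1 = ∑ b, avgLik p b * (density p c b - 1) ^ 2 := by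
  have : ∀ b, avgLik p b * (density p c b - 1) ^ 2 =
      avgLik p b * (density p c b * density p c b) - 2 * (avgLik p b * density p c b)
        + avgLik p b := fun b => by ring
  simp only [this, Finset.sum_add_distrib, Finset.sum_sub_distrib, ← Finset.mul_sum]
  rw [← overlap_eq_sum_density, hp.sum_avgLik_mul_density hk, hp.sum_avgLik hk]
  ring

lemma IsChannel.one_le_overlap (hk : 2 ≤ k) {p : Fin k → B → ℝ} (hp : IsChannel p)
    (c : Fin k) : 1 ≤ overlap p c c := by
  rw [← sub_nonneg, hp.overlap_self_sub_one hk]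
  exact Finset.sum_nonneg fun b _ => mul_nonneg (hp.avgLik_nonneg b) (sq_nonneg _)

/-- The chi-square contribution of nonnegative densities is bounded by their variances, even where
their average is small. -/
lemma sum_sq_div_avg_sub_avg_le (hk : 2 ≤ k) (W : Fin k → ℝ) (hW : ∀ c, 0 ≤ W c) :
    (∑ c, W c ^ 2 / ((∑ c', W c') / k)) / k - (∑ c, W c) / k ≤
      2 / k * ∑ c, (W c - 1) ^ 2 + 2 * k * ((∑ c, W c) / k - 1) ^ 2 := by
  have hk0 : (0 : ℝ) < k := by positivity
  set M := (∑ c, W c) / k with hM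
  have hS : ∑ c, W c = k * M := by rw [hM]; field_simp
  have hM0 : 0 ≤ M := div_nonneg (Finset.sum_nonneg fun c _ => hW c) hk0.le
  have hQ : ∑ c, (W c - 1) ^ 2 = ∑ c, W c ^ 2 - 2 * (k * M) + k := by
    rw [← hS]
    simp only [sub_sq, Finset.sum_add_distrib, Finset.sum_sub_distrib, Finset.mul_sum, mul_one,
      one_pow]
    simp
  have hQ0 : 0 ≤ ∑ c, (W c - 1) ^ 2 := Finset.sum_nonneg fun c _ => sq_nonneg _
  rw [← Finset.sum_div]
  set Q := ∑ c, W c ^ 2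
  have hQle : Q ≤ (k * M) ^ 2 := by
    rw [← hS]; exact Finset.sum_sq_le_sq_sum_of_nonneg fun c _ => hW c
  have hQM : k * M ^ 2 ≤ Q := by
    have h := @sq_sum_le_card_mul_sum_sq _ _ _ _ _ _ (Finset.univ : Finset (Fin k)) W
    rw [hS, Finset.card_univ, Fintype.card_fin] at h
    have : (k : ℝ) * (k * M ^ 2) ≤ k * Q := by nlinarith
    exact le_of_mul_le_mul_left this hk0
  -- For M ≥ 1/2 the division by M costs at most a factor 2. For M < 1/2 the bound Q ≤ (kM)² leaves
  -- at most kM, and M < 1/2 < 2(M - 1)².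
  rcases le_or_gt (1 / 2) M with h | h
  · have hMp : 0 < M := by linarith
    have h1 : Q / M / k - M = (Q - k * M ^ 2) / k / M := by field_simp
    have h2 : (Q - k * M ^ 2) / k / M ≤ 2 / k * (Q - k * M ^ 2) := by
      rw [div_le_iff₀ hMp, div_le_iff₀ hk0]
      have : 2 / (k : ℝ) * (Q - k * M ^ 2) * M * k = 2 * M * (Q - k * M ^ 2) := by field_simp
      rw [this]; nlinarith
    have h3 : Q - k * M ^ 2 ≤ ∑ c, (W c - 1) ^ 2 := by
      rw [hQ]; nlinarith [sq_nonneg (M - 1)]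
    have h4 : 2 / (k : ℝ) * (Q - k * M ^ 2) ≤ 2 / k * ∑ c, (W c - 1) ^ 2 := by gcongr
    have h5 : 0 ≤ 2 * (k : ℝ) * (M - 1) ^ 2 := by positivity
    linarith
  · have h1 : Q / M / k ≤ k * M := by
      rcases hM0.eq_or_lt with h0 | h0
      · rw [← h0]; simp
      · rw [div_le_iff₀ hk0, div_le_iff₀ h0]; nlinarith
    have h2 : (k : ℝ) * M ≤ 2 * k * (M - 1) ^ 2 := by
      have : M ≤ 2 * (M - 1) ^ 2 := by nlinarith
      nlinarith
    have h3 : 0 ≤ 2 / (k : ℝ) * ∑ c, (W c - 1) ^ 2 := by positivity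
    linarith

lemma IsChannel.density_le (hk : 2 ≤ k) {p : Fin k → B → ℝ} (hp : IsChannel p) (c : Fin k)
    (b : B) : density p c b ≤ k := by
  unfold density
  rcases (hp.avgLik_nonneg b).eq_or_lt with h | h
  · rw [← h]; simp
  · rw [div_le_iff₀ h, ← sum_eq_mul_avgLik hk p b]
    exact hp.le_sum c b

/-- The density of one factor of `branch d p c`. -/
def branchFactor (p : Fin k → B → ℝ) (c : Fin k) (b : B) : ℝ :=
  ((k : ℝ) - density p c b) / ((k : ℝ) - 1)

lemma IsChannel.branchFactor_nonneg (hk : 2 ≤ k) {p : Fin k → B → ℝ} (hp : IsChannel p)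
    (c : Fin k) (b : B) : 0 ≤ branchFactor p c b := by
  have : (2 : ℝ) ≤ k := by exact_mod_cast hk
  exact div_nonneg (sub_nonneg.2 (hp.density_le hk c b)) (by linarith)

lemma IsChannel.branch_eq (hk : 2 ≤ k) {d : ℕ} {p : Fin k → B → ℝ} (hp : IsChannel p) (c : Fin k)
    (b : Fin d → B) :
    TreeColoring.branch d p c b = (∏ i, avgLik p (b i)) * ∏ i, branchFactor p c (b i) := by
  rw [← Finset.prod_mul_distrib]
  refine Finset.prod_congr rfl fun i _ => ?_
  rw [sum_eq_mul_avgLik hk, hp.eq_avgLik_mul_density hk c (b i), branchFactor]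
  ring

lemma sum_prod_mul_prod (d : ℕ) (m g : B → ℝ) :
    ∑ b : Fin d → B, (∏ i, m (b i)) * ∏ i, g (b i) = (∑ b, m b * g b) ^ d := by
  simp_rw [Fintype.sum_pow, Finset.prod_mul_distrib]

lemma IsChannel.sum_avgLik_mul_branchFactor (hk : 2 ≤ k) {p : Fin k → B → ℝ} (hp : IsChannel p)
    (c : Fin k) : ∑ b, avgLik p b * branchFactor p c b = 1 := by
  have : (2 : ℝ) ≤ k := by exact_mod_cast hk
  have hne : (k : ℝ) - 1 ≠ 0 := by linarith
  have : ∀ b, avgLik p b * branchFactor p c b =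
      (k / ((k : ℝ) - 1)) * avgLik p b - (1 / ((k : ℝ) - 1)) * (avgLik p b * density p c b) := by
    intro b; unfold branchFactor; ring
  simp only [this, Finset.sum_sub_distrib, ← Finset.mul_sum]
  rw [hp.sum_avgLik hk, hp.sum_avgLik_mul_density hk]
  field_simp

lemma IsChannel.sum_avgLik_mul_branchFactor_mul (hk : 2 ≤ k) {p : Fin k → B → ℝ}
    (hp : IsChannel p) (c c' : Fin k) :
    ∑ b, avgLik p b * (branchFactor p c b * branchFactor p c' b) =
      1 + (overlap p c c' - 1) / ((k : ℝ) - 1) ^ 2 := by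
  have : (2 : ℝ) ≤ k := by exact_mod_cast hk
  have hne : (k : ℝ) - 1 ≠ 0 := by linarith
  have : ∀ b, avgLik p b * (branchFactor p c b * branchFactor p c' b) =
      (1 / ((k : ℝ) - 1) ^ 2) * (k ^ 2 * avgLik p b - k * (avgLik p b * density p c b)
        - k * (avgLik p b * density p c' b)
        + avgLik p b * (density p c b * density p c' b)) := by
    intro b; unfold branchFactor; field_simp; ring
  simp only [this, Finset.sum_sub_distrib, Finset.sum_add_distrib, ← Finset.mul_sum]
  rw [hp.sum_avgLik hk, hp.sum_avgLik_mul_density hk, hp.sum_avgLik_mul_density hk,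
    ← overlap_eq_sum_density]
  field_simp
  ring

/-- The chi-square divergence of `branch d p` in terms of the one of `p`, for a channel whose
outputs at distinct inputs are negatively correlated. -/
theorem IsChannel.chiSq_branch_le (hk : 2 ≤ k) (d : ℕ) {p : Fin k → B → ℝ} (hp : IsChannel p)
    {D : ℝ} (hdiag : ∀ c, overlap p c c = 1 + D)
    (hoff : ∀ c c', c ≠ c' → overlap p c c' ≤ 1) :
    chiSq (TreeColoring.branch d p) ≤ 4 * ((1 + D / ((k : ℝ) - 1) ^ 2) ^ d - 1) := by
  have hk2 : (2 : ℝ) ≤ k := by exact_mod_cast hk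
  have hk0 : (0 : ℝ) < k := by positivity
  -- The reference law `ν` is a product, so moments of the densities `W c` factor over the children.
  -- It is not the averaged output law of the branched channel; that one has density (∑ c, W c)/k
  -- with respect to `ν`.
  set ν : (Fin d → B) → ℝ := fun b => ∏ i, avgLik p (b i) with hν
  set W : Fin k → (Fin d → B) → ℝ := fun c b => ∏ i, branchFactor p c (b i) with hW
  set V : ℝ := (1 + D / ((k : ℝ) - 1) ^ 2) ^ d with hV
  have hν0 : ∀ b, 0 ≤ ν b := fun b => Finset.prod_nonneg fun i _ => hp.avgLik_nonneg _
  have hW0 : ∀ c b, 0 ≤ W c b := fun c b =>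
    Finset.prod_nonneg fun i _ => hp.branchFactor_nonneg hk _ _
  have hν1 : ∑ b, ν b = 1 := by
    have h := sum_prod_mul_prod d (avgLik p) (fun _ => 1)
    simpa [hp.sum_avgLik hk] using h
  have hW1 : ∀ c, ∑ b, ν b * W c b = 1 := by
    intro c
    have h := sum_prod_mul_prod d (avgLik p) (branchFactor p c)
    rwa [hp.sum_avgLik_mul_branchFactor hk, one_pow] at h
  have hWW : ∀ c c', ∑ b, ν b * (W c b * W c' b) =
      (1 + (overlap p c c' - 1) / ((k : ℝ) - 1) ^ 2) ^ d := by
    intro c c'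
    have h := sum_prod_mul_prod d (avgLik p) (fun b => branchFactor p c b * branchFactor p c' b)
    rw [hp.sum_avgLik_mul_branchFactor_mul hk] at h
    rw [← h]
    simp only [hν, hW, Finset.prod_mul_distrib]
  have hdiag' : ∀ c, ∑ b, ν b * (W c b * W c b) = V := by
    intro c; rw [hWW, hdiag, add_sub_cancel_left]
  have hoff' : ∀ c c', c ≠ c' → ∑ b, ν b * (W c b * W c' b) ≤ 1 := by
    intro c c' hcc
    rw [hWW]
    refine pow_le_one₀ ?_ ?_
    · rw [← hp.sum_avgLik_mul_branchFactor_mul hk]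
      exact Finset.sum_nonneg fun b _ => mul_nonneg (hp.avgLik_nonneg b)
        (mul_nonneg (hp.branchFactor_nonneg hk _ _) (hp.branchFactor_nonneg hk _ _))
    · have : (overlap p c c' - 1) / ((k : ℝ) - 1) ^ 2 ≤ 0 :=
        div_nonpos_of_nonpos_of_nonneg (by linarith [hoff c c' hcc]) (sq_nonneg _)
      linarith
  have hsumW : ∑ b, ν b * ∑ c, W c b = k := by
    simp only [Finset.mul_sum]
    rw [Finset.sum_comm]
    simp [hW1]
  have hvar : ∀ c, ∑ b, ν b * (W c b - 1) ^ 2 = V - 1 := by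
    intro c
    have : ∀ b, ν b * (W c b - 1) ^ 2 = ν b * (W c b * W c b) - 2 * (ν b * W c b) + ν b :=
      fun b => by ring
    simp only [this, Finset.sum_add_distrib, Finset.sum_sub_distrib, ← Finset.mul_sum]
    rw [hdiag', hW1, hν1]; ring
  have hcov : ∑ b, ν b * (∑ c, W c b) ^ 2 ≤ k * V + k * (k - 1) := by
    have h1 : ∀ b, ν b * (∑ c, W c b) ^ 2 = ∑ c, ∑ c', ν b * (W c b * W c' b) := by
      intro b
      rw [sq, Finset.sum_mul_sum, Finset.mul_sum]
      simp only [Finset.mul_sum]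
    simp only [h1]
    rw [Finset.sum_comm]
    have h2 : ∀ c, ∑ b, ∑ c', ν b * (W c b * W c' b) ≤ V + (k - 1) := by
      intro c
      rw [Finset.sum_comm, ← Finset.add_sum_erase _ _ (Finset.mem_univ c), hdiag']
      have h3 := Finset.sum_le_card_nsmul (Finset.univ.erase c)
        (fun c' => ∑ b, ν b * (W c b * W c' b)) 1
        (fun c' hc' => hoff' c c' (Finset.ne_of_mem_erase hc').symm)
      rw [Finset.card_erase_of_mem (Finset.mem_univ c), Finset.card_univ, Fintype.card_fin,
        nsmul_eq_mul, mul_one, Nat.cast_sub (by omega)] at h3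
      simpa using h3
    refine (Finset.sum_le_sum fun c _ => h2 c).trans (le_of_eq ?_)
    simp
  -- Nonpositive correlation gains a factor 1/k in the variance of the average, which pays for the
  -- 2k in `sum_sq_div_avg_sub_avg_le`. The two terms of that bound then contribute 2(V - 1) each.
  have hvar' : ∑ b, ν b * ((∑ c, W c b) / k - 1) ^ 2 ≤ (V - 1) / k := by
    have : ∀ b, ν b * ((∑ c, W c b) / k - 1) ^ 2 = (1 / (k : ℝ) ^ 2) * (ν b * (∑ c, W c b) ^ 2)
        - (2 / k) * (ν b * ∑ c, W c b) + ν b := fun b => by field_simp; ring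
    simp only [this, Finset.sum_add_distrib, Finset.sum_sub_distrib, ← Finset.mul_sum]
    rw [hsumW, hν1]
    have h : (1 / (k : ℝ) ^ 2) * ∑ b, ν b * (∑ c, W c b) ^ 2 ≤
        (1 / (k : ℝ) ^ 2) * (k * V + k * (k - 1)) := by gcongr
    have h' : (1 / (k : ℝ) ^ 2) * (k * V + k * (k - 1)) - 2 / k * k + 1 = (V - 1) / k := by
      field_simp; ring
    linarith
  have havg : ∀ b, avgLik (TreeColoring.branch d p) b = ν b * ((∑ c, W c b) / k) := by
    intro b
    unfold avgLik
    simp only [hp.branch_eq hk]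
    rw [← Finset.mul_sum, mul_div_assoc]
  have hoverlap : ∀ c, overlap (TreeColoring.branch d p) c c =
      ∑ b, ν b * (W c b ^ 2 / ((∑ c', W c' b) / k)) := by
    intro c
    refine Finset.sum_congr rfl fun b _ => ?_
    rw [havg, hp.branch_eq hk]
    change ν b * W c b * (ν b * W c b) / _ = _
    by_cases hb : ν b = 0
    · rw [hb]; simp
    · rw [mul_mul_mul_comm, mul_assoc, mul_div_mul_left _ _ hb, ← sq, mul_div_assoc]
  have hchi : chiSq (TreeColoring.branch d p) = ∑ b, ν b *
      ((∑ c, W c b ^ 2 / ((∑ c', W c' b) / k)) / k - (∑ c, W c b) / k) := by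
    have h1 : (∑ b, ν b * ((∑ c, W c b) / k)) = 1 := by
      simp only [← mul_div_assoc]
      rw [← Finset.sum_div, hsumW, div_self hk0.ne']
    simp only [mul_sub, Finset.sum_sub_distrib]
    rw [h1, chiSq]
    simp only [hoverlap, Finset.sum_div, Finset.mul_sum]
    rw [Finset.sum_comm]
    simp only [mul_div_assoc]
  have hmul : 2 * (k : ℝ) * ∑ b, ν b * ((∑ c, W c b) / k - 1) ^ 2 ≤ 2 * k * ((V - 1) / k) := by
    gcongr
  have hvars : ∑ b, ν b * ∑ c, (W c b - 1) ^ 2 = k * (V - 1) := by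
    simp only [Finset.mul_sum]
    rw [Finset.sum_comm]
    simp [hvar, mul_sub]
  rw [hchi]
  calc _ ≤ ∑ b, ν b * (2 / k * ∑ c, (W c b - 1) ^ 2 + 2 * k * ((∑ c, W c b) / k - 1) ^ 2) :=
        Finset.sum_le_sum fun b _ => mul_le_mul_of_nonneg_left
          (sum_sq_div_avg_sub_avg_le hk (fun c => W c b) fun c => hW0 c b) (hν0 b)
    _ = 2 / k * (∑ b, ν b * ∑ c, (W c b - 1) ^ 2)
        + 2 * k * ∑ b, ν b * ((∑ c, W c b) / k - 1) ^ 2 := by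
      simp only [mul_add, Finset.sum_add_distrib, Finset.mul_sum]
      congr 1 <;> refine Finset.sum_congr rfl fun b _ => ?_
      · exact Finset.sum_congr rfl fun c _ => by ring
      · ring
    _ ≤ 2 / k * (k * (V - 1)) + 2 * k * ((V - 1) / k) := by rw [hvars]; linarith
    _ = 4 * (V - 1) := by field_simp; ring

end Channel

/-! ### The likelihood of a boundary condition -/

section Boundary

/-- The colorings of the leaves of the complete tree of depth `n`, organized along the tree. -/
def Boundary (Δ k : ℕ) : ℕ → Type
  | 0 => Fin k
  | n + 1 => Fin Δ → Boundary Δ k n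

instance Boundary.instFintype (Δ k : ℕ) : ∀ n, Fintype (Boundary Δ k n)
  | 0 => inferInstanceAs (Fintype (Fin k))
  | n + 1 => by
    classical
    haveI := Boundary.instFintype Δ k n
    exact inferInstanceAs (Fintype (Fin Δ → Boundary Δ k n))

variable {Δ k : ℕ}

/-- The probability of the leaf coloring `b` of the tree of depth `n` given the root color `c`. -/
def lik : ∀ n, Fin k → Boundary Δ k n → ℝ
  | 0, c, b => if (show Fin k from b) = c then 1 else 0
  | n + 1, c, b => branch Δ (lik n) c b

lemma sum_boundary_succ {n : ℕ} (f : Boundary Δ k (n + 1) → ℝ) :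
    ∑ b, f b = ∑ b : Fin Δ → Boundary Δ k n, f b :=
  Fintype.sum_equiv (Equiv.refl _) _ _ fun _ => rfl

lemma sum_boundary_zero (f : Boundary Δ k 0 → ℝ) : ∑ b, f b = ∑ b : Fin k, f b :=
  Fintype.sum_equiv (Equiv.refl _) _ _ fun _ => rfl

lemma isChannel_lik (hk : 2 ≤ k) : ∀ n, IsChannel (lik n : Fin k → Boundary Δ k n → ℝ)
  | 0 =>
    { nonneg := fun c b => by unfold lik; split_ifs <;> norm_num
      sum_eq_one := fun c => by
        rw [sum_boundary_zero]
        simp [lik] }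
  | n + 1 =>
    { nonneg := fun c b => ((isChannel_lik hk n).branch hk Δ).nonneg c b
      sum_eq_one := fun c => by
        rw [sum_boundary_succ]
        exact ((isChannel_lik hk n).branch hk Δ).sum_eq_one c }

/-! ### Color symmetry of the broadcast channel -/

/-- The action of color permutations on boundary conditions. -/
def Boundary.perm (e : Equiv.Perm (Fin k)) : ∀ n, Boundary Δ k n ≃ Boundary Δ k n
  | 0 => e
  | n + 1 => Equiv.arrowCongr (Equiv.refl _) (Boundary.perm e n)

lemma lik_perm (e : Equiv.Perm (Fin k)) : ∀ (n : ℕ) (c : Fin k) (b : Boundary Δ k n),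
    lik n (e c) (Boundary.perm e n b) = lik n c b
  | 0, c, b => by
    change (if e b = e c then (1 : ℝ) else 0) = if (show Fin k from b) = c then 1 else 0
    exact if_congr e.injective.eq_iff rfl rfl
  | n + 1, c, b => by
    change ∏ i, (∑ c', lik n c' (Boundary.perm e n (b i)) -
      lik n (e c) (Boundary.perm e n (b i))) / ((k : ℝ) - 1) =
      ∏ i, (∑ c', lik n c' (b i) - lik n c (b i)) / ((k : ℝ) - 1)
    refine Finset.prod_congr rfl fun i _ => ?_
    rw [lik_perm e n, ← Equiv.sum_comp e fun c' => lik n c' (Boundary.perm e n (b i))]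
    simp only [lik_perm e n]

/-- The symmetric group acts doubly transitively on colors, so the overlap matrix has one diagonal
value and one off-diagonal value. -/
lemma overlap_lik_perm (e : Equiv.Perm (Fin k)) (n : ℕ) (c c' : Fin k) :
    overlap (lik n : Fin k → Boundary Δ k n → ℝ) (e c) (e c') =
      overlap (lik n : Fin k → Boundary Δ k n → ℝ) c c' := by
  unfold overlap
  rw [← Equiv.sum_comp (Boundary.perm e n)]
  refine Finset.sum_congr rfl fun b _ => ?_
  have : avgLik (lik n) (Boundary.perm e n b) = avgLik (lik n) b := by
    unfold avgLik
    rw [← Equiv.sum_comp e fun c' => lik n c' (Boundary.perm e n b)]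
    simp only [lik_perm]
  rw [lik_perm, lik_perm, this]

variable (Δ k) in
/-- The chi-square divergence of the leaf coloring given the root color. -/
def rootInfo (n : ℕ) : ℝ := chiSq (lik n : Fin k → Boundary Δ k n → ℝ)

lemma overlap_lik_self (hk : 2 ≤ k) (n : ℕ) (c : Fin k) :
    overlap (lik n : Fin k → Boundary Δ k n → ℝ) c c = 1 + rootInfo Δ k n := by
  have h : ∀ c', overlap (lik n : Fin k → Boundary Δ k n → ℝ) c' c' =
      overlap (lik n : Fin k → Boundary Δ k n → ℝ) c c := by
    intro c'
    have := overlap_lik_perm (Δ := Δ) (Equiv.swap c c') n c c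
    rwa [Equiv.swap_apply_left] at this
  have hk0 : (k : ℝ) ≠ 0 := by positivity
  unfold rootInfo chiSq
  simp only [h]
  simp [hk0]

lemma rootInfo_nonneg (hk : 2 ≤ k) (n : ℕ) : 0 ≤ rootInfo Δ k n := by
  have h := (isChannel_lik (Δ := Δ) hk n).one_le_overlap hk ⟨0, by omega⟩
  rw [overlap_lik_self hk] at h
  linarith

/-- The row sum is k, the diagonal entry is 1 + D with D ≥ 0, and the other k - 1 entries are equal;
each is therefore 1 - D/(k - 1). -/
lemma overlap_lik_le_one (hk : 2 ≤ k) (n : ℕ) {c c' : Fin k} (h : c ≠ c') :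
    overlap (lik n : Fin k → Boundary Δ k n → ℝ) c c' ≤ 1 := by
  have hk2 : (2 : ℝ) ≤ k := by exact_mod_cast hk
  have heq : ∀ d ∈ Finset.univ.erase c,
      overlap (lik n : Fin k → Boundary Δ k n → ℝ) c d =
      overlap (lik n : Fin k → Boundary Δ k n → ℝ) c c' := by
    intro d hd
    have := overlap_lik_perm (Δ := Δ) (Equiv.swap c' d) n c c'
    rwa [Equiv.swap_apply_left, Equiv.swap_apply_of_ne_of_ne h
      (Finset.ne_of_mem_erase hd).symm] at this
  have hsum := (isChannel_lik (Δ := Δ) hk n).sum_overlap hk c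
  rw [← Finset.add_sum_erase _ _ (Finset.mem_univ c), Finset.sum_congr rfl heq,
    overlap_lik_self hk, Finset.sum_const, Finset.card_erase_of_mem (Finset.mem_univ c),
    Finset.card_univ, Fintype.card_fin, nsmul_eq_mul, Nat.cast_sub (by omega), Nat.cast_one]
    at hsum
  have := rootInfo_nonneg (Δ := Δ) hk n
  nlinarith

lemma rootInfo_zero (hk : 2 ≤ k) : rootInfo Δ k 0 = k - 1 := by
  have hk0 : (k : ℝ) ≠ 0 := by positivity
  have h := overlap_lik_self (Δ := Δ) hk 0 ⟨0, by omega⟩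
  unfold overlap avgLik at h
  rw [sum_boundary_zero] at h
  simp [lik] at h
  linarith

theorem rootInfo_succ_le (hk : 2 ≤ k) (n : ℕ) :
    rootInfo Δ k (n + 1) ≤ 4 * ((1 + rootInfo Δ k n / ((k : ℝ) - 1) ^ 2) ^ Δ - 1) := by
  have h := (isChannel_lik (Δ := Δ) hk n).chiSq_branch_le hk Δ (overlap_lik_self hk n)
    fun c c' => overlap_lik_le_one hk n
  convert h using 1
  unfold rootInfo chiSq overlap
  simp only [sum_boundary_succ]
  rfl

end Boundary

/-! ### Decay of the root information -/

lemma one_add_pow_sub_one_le {x : ℝ} (hx : 0 ≤ x) (d : ℕ) (h : d * x ≤ 1) :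
    (1 + x) ^ d - 1 ≤ 2 * (d * x) := by
  have h1 : (1 + x) ^ d ≤ Real.exp (d * x) := by
    rw [Real.exp_nat_mul]
    exact pow_le_pow_left₀ (by linarith) (by linarith [Real.add_one_le_exp x]) d
  have h0 : 0 ≤ d * x := by positivity
  have h2 := Real.abs_exp_sub_one_le (x := d * x) (by rwa [abs_of_nonneg h0])
  rw [abs_of_nonneg h0] at h2
  linarith [le_abs_self (Real.exp (d * x) - 1)]

/-- Contraction of the root information once a single step has brought it below `A`. -/
lemma rootInfo_le_of_contraction {Δ k : ℕ} (hk : 2 ≤ k) {A θ : ℝ} (hθ : θ ≤ 1)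
    (h1 : 4 * Real.exp (Δ / ((k : ℝ) - 1)) ≤ A) (hA : Δ * (A / ((k : ℝ) - 1) ^ 2) ≤ 1)
    (hc : 8 * Δ / ((k : ℝ) - 1) ^ 2 ≤ θ) (n : ℕ) : rootInfo Δ k (n + 1) ≤ A * θ ^ n := by
  have hk2 : (2 : ℝ) ≤ k := by exact_mod_cast hk
  have hk1 : (0 : ℝ) < k - 1 := by linarith
  have hA0 : 0 ≤ A := le_trans (by positivity) h1
  have hθ0 : 0 ≤ θ := le_trans (by positivity) hc
  induction n with
  | zero =>
    have h := rootInfo_succ_le (Δ := Δ) hk 0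
    rw [rootInfo_zero hk] at h
    have h3 : ((k : ℝ) - 1) / ((k : ℝ) - 1) ^ 2 = 1 / (k - 1) := by field_simp
    -- The first step need not lie in the linear regime, so only the exponential bound is used.
    have h2 : (1 + 1 / ((k : ℝ) - 1)) ^ Δ ≤ Real.exp (Δ / ((k : ℝ) - 1)) := by
      rw [div_eq_mul_one_div (Δ : ℝ), Real.exp_nat_mul]
      exact pow_le_pow_left₀ (by positivity)
        (by linarith [Real.add_one_le_exp (1 / ((k : ℝ) - 1))]) Δ
    rw [h3] at h
    rw [pow_zero, mul_one]
    linarith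
  | succ n ih =>
    have h := rootInfo_succ_le (Δ := Δ) hk (n + 1)
    have hx : 0 ≤ rootInfo Δ k (n + 1) / ((k : ℝ) - 1) ^ 2 :=
      div_nonneg (rootInfo_nonneg hk _) (sq_nonneg _)
    have hle : rootInfo Δ k (n + 1) ≤ A := ih.trans (mul_le_of_le_one_right hA0 (pow_le_one₀ hθ0 hθ))
    have hx1 : Δ * (rootInfo Δ k (n + 1) / ((k : ℝ) - 1) ^ 2) ≤ 1 := le_trans (by gcongr) hA
    have h2 := one_add_pow_sub_one_le hx Δ hx1
    -- The 8 is the 4 of the recursion times the 2 of the linearization.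
    calc rootInfo Δ k (n + 1 + 1) ≤ 8 * Δ / ((k : ℝ) - 1) ^ 2 * rootInfo Δ k (n + 1) := by
          refine h.trans ((mul_le_mul_of_nonneg_left h2 (by norm_num)).trans (le_of_eq ?_))
          ring
      _ ≤ θ * (A * θ ^ n) := mul_le_mul hc ih (rootInfo_nonneg hk _) hθ0
      _ = A * θ ^ (n + 1) := by ring

lemma eventually_log_le_mul_rpow {c r : ℝ} (hc : 0 < c) (hr : 0 < r) :
    ∀ᶠ d : ℕ in atTop, Real.log d ≤ c * (d : ℝ) ^ r := by
  have h := ((isLittleO_log_rpow_atTop hr).comp_tendsto tendsto_natCast_atTop_atTop).bound hc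
  filter_upwards [h] with d hd
  have h1 : ‖(d : ℝ) ^ r‖ = (d : ℝ) ^ r := by
    rw [Real.norm_eq_abs, abs_of_nonneg (by positivity)]
  simp only [Function.comp_apply, h1] at hd
  exact (le_abs_self _).trans hd

/-- Half of ε absorbs the passage from k to k - 1, so Δ/(k - 1) ≤ s log Δ with s = 1/(1 + ε/2) < 1
and the first step lands below 4 Δ^s. Since (k - 1)² is at least (Δ/log Δ)², what remains is that
log² Δ is beaten by small powers of Δ. -/
theorem eventually_rootInfo_le {ε : ℝ} (hε : 0 < ε) :
    ∀ᶠ Δ : ℕ in atTop, 2 ≤ Δ ∧ ∀ k : ℕ, (1 + ε) * Δ / Real.log Δ < k →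
      2 ≤ k ∧ ∀ n : ℕ, rootInfo Δ k (n + 1) ≤ 4 * Δ * ((Δ : ℝ) ^ (-(1 / 2) : ℝ)) ^ n := by
  set s : ℝ := 1 / (1 + ε / 2) with hs
  have hs1 : s < 1 := by rw [hs, div_lt_one (by linarith)]; linarith
  -- In order: room for k - 1 in place of k; Δ · 4 Δ^s/(k - 1)² ≤ 1, where squaring 1/2 cancels the
  -- 4; and 8Δ/(k - 1)² ≤ Δ^(-1/2), where 1/9 ≤ 1/8.
  filter_upwards [eventually_log_le_mul_rpow (c := ε / 2) (r := 1) (by positivity) one_pos,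
    eventually_log_le_mul_rpow (c := 1 / 2) (r := (1 - s) / 2) (by norm_num) (by linarith),
    eventually_log_le_mul_rpow (c := 1 / 3) (r := 1 / 4) (by norm_num) (by norm_num),
    eventually_ge_atTop 2] with Δ e1 e2 e3 hΔ
  refine ⟨hΔ, fun k hk => ?_⟩
  have hΔ2 : (2 : ℝ) ≤ Δ := by exact_mod_cast hΔ
  have hΔ0 : (0 : ℝ) < Δ := by linarith
  have hlog : 0 < Real.log Δ := Real.log_pos (by linarith)
  rw [Real.rpow_one] at e1
  have hk1 : (1 + ε / 2) * Δ / Real.log Δ < k - 1 := by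
    have : 1 ≤ ε / 2 * Δ / Real.log Δ := by rwa [le_div_iff₀ hlog, one_mul]
    have h2 : (1 + ε) * Δ / Real.log Δ =
      (1 + ε / 2) * Δ / Real.log Δ + ε / 2 * Δ / Real.log Δ := by ring
    linarith
  have hlogle : Real.log Δ ≤ Δ := Real.log_le_self hΔ0.le
  have hkone : (1 : ℝ) < k - 1 := by
    refine lt_of_le_of_lt ?_ hk1
    rw [le_div_iff₀ hlog]
    nlinarith
  have hkpos : (0 : ℝ) < k - 1 := by linarith
  have hk2 : 2 ≤ k := by
    have : (2 : ℝ) < k := by linarith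
    exact_mod_cast this.le
  refine ⟨hk2, fun n => ?_⟩
  have hdk : Δ / ((k : ℝ) - 1) ≤ Real.log Δ * s := by
    rw [div_le_iff₀ hkpos, hs]
    rw [div_lt_iff₀ hlog] at hk1
    have : (0 : ℝ) < 1 + ε / 2 := by linarith
    have h : Real.log Δ * (1 / (1 + ε / 2)) * (k - 1) =
      (k - 1) * Real.log Δ / (1 + ε / 2) := by ring
    rw [h, le_div_iff₀ this]
    linarith
  have hdk' : Δ / ((k : ℝ) - 1) ≤ Real.log Δ :=
    hdk.trans (mul_le_of_le_one_right hlog.le hs1.le)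
  have hsq : Δ / ((k : ℝ) - 1) ^ 2 ≤ Real.log Δ ^ 2 / Δ := by
    rw [le_div_iff₀ hΔ0]
    calc Δ / ((k : ℝ) - 1) ^ 2 * Δ = (Δ / ((k : ℝ) - 1)) ^ 2 := by rw [div_pow]; ring
      _ ≤ _ := by gcongr
  have hθ : (Δ : ℝ) ^ (-(1 / 2) : ℝ) ≤ 1 :=
    Real.rpow_le_one_of_one_le_of_nonpos (by linarith) (by norm_num)
  have hmain := rootInfo_le_of_contraction (Δ := Δ) (k := k) hk2
    (A := 4 * (Δ : ℝ) ^ s) (θ := (Δ : ℝ) ^ (-(1 / 2) : ℝ)) hθ ?_ ?_ ?_ n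
  · refine hmain.trans ?_
    gcongr
    calc (Δ : ℝ) ^ s ≤ (Δ : ℝ) ^ (1 : ℝ) :=
          Real.rpow_le_rpow_of_exponent_le (by linarith) hs1.le
      _ = Δ := Real.rpow_one _
  · rw [Real.rpow_def_of_pos hΔ0]
    gcongr
  · have h1 : Real.log Δ ^ 2 ≤ 1 / 4 * (Δ : ℝ) ^ (1 - s) := by
      calc Real.log Δ ^ 2 ≤ (1 / 2 * (Δ : ℝ) ^ ((1 - s) / 2)) ^ 2 := by gcongr
        _ = 1 / 4 * ((Δ : ℝ) ^ ((1 - s) / 2) * (Δ : ℝ) ^ ((1 - s) / 2)) := by ring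
        _ = _ := by rw [← Real.rpow_add hΔ0]; ring_nf
    calc (Δ : ℝ) * (4 * (Δ : ℝ) ^ s / ((k : ℝ) - 1) ^ 2)
        = 4 * (Δ : ℝ) ^ s * (Δ / ((k : ℝ) - 1) ^ 2) := by ring
      _ ≤ 4 * (Δ : ℝ) ^ s * ((1 / 4 * (Δ : ℝ) ^ (1 - s)) / Δ) := by
        refine mul_le_mul_of_nonneg_left (hsq.trans ?_) (by positivity)
        gcongr
      _ = ((Δ : ℝ) ^ s * (Δ : ℝ) ^ (1 - s)) / Δ := by ring
      _ = 1 := by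
        rw [← Real.rpow_add hΔ0, add_sub_cancel, Real.rpow_one, div_self hΔ0.ne']
  · have h1 : Real.log Δ ^ 2 ≤ 1 / 8 * (Δ : ℝ) ^ (1 / 2 : ℝ) := by
      calc Real.log Δ ^ 2 ≤ (1 / 3 * (Δ : ℝ) ^ (1 / 4 : ℝ)) ^ 2 := by gcongr
        _ = 1 / 9 * ((Δ : ℝ) ^ (1 / 4 : ℝ) * (Δ : ℝ) ^ (1 / 4 : ℝ)) := by ring
        _ = 1 / 9 * (Δ : ℝ) ^ (1 / 2 : ℝ) := by rw [← Real.rpow_add hΔ0]; norm_num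
        _ ≤ _ := by gcongr; norm_num
    calc 8 * (Δ : ℝ) / ((k : ℝ) - 1) ^ 2 = 8 * (Δ / ((k : ℝ) - 1) ^ 2) := by ring
      _ ≤ 8 * ((1 / 8 * (Δ : ℝ) ^ (1 / 2 : ℝ)) / Δ) := by
        refine mul_le_mul_of_nonneg_left (hsq.trans ?_) (by norm_num)
        gcongr
      _ = (Δ : ℝ) ^ (1 / 2 : ℝ) / (Δ : ℝ) ^ (1 : ℝ) := by rw [Real.rpow_one]; ring
      _ = _ := by rw [← Real.rpow_sub hΔ0]; norm_num

/-! ### The free-boundary measure on the infinite tree -/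

section Free

variable {Δ k : ℕ}

/-- The vertices of depth at most `m`, as a finite set. -/
def ballFinset (Δ m : ℕ) : Finset (List (Fin Δ)) := (List.finite_length_le (Fin Δ) m).toFinset

/-- The vertices of depth `m`. -/
def level (Δ m : ℕ) : Finset (List (Fin Δ)) := (List.finite_length_eq (Fin Δ) m).toFinset

@[simp] lemma mem_ballFinset {m : ℕ} {v : List (Fin Δ)} : v ∈ ballFinset Δ m ↔ v.length ≤ m := by
  simp [ballFinset]

@[simp] lemma mem_level {m : ℕ} {v : List (Fin Δ)} : v ∈ level Δ m ↔ v.length = m := by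
  simp [level]

lemma prod_level_succ {M : Type*} [CommMonoid M] (m : ℕ) (f : List (Fin Δ) → M) :
    ∏ w ∈ level Δ (m + 1), f w = ∏ v ∈ level Δ m, ∏ a, f (a :: v) := by
  rw [← Finset.prod_product']
  symm
  refine Finset.prod_bij (fun x _ => x.2 :: x.1) ?_ ?_ ?_ ?_
  · rintro ⟨v, a⟩ h
    simpa using h
  · rintro ⟨v, a⟩ _ ⟨v', a'⟩ _ h
    simp only [List.cons.injEq] at h
    simp [h.1, h.2]
  · intro w hw
    cases w with
    | nil => simp at hw
    | cons a v => exact ⟨(v, a), by simpa using hw, rfl⟩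
  · rintro _ _; rfl

lemma ballFinset_succ (m : ℕ) :
    ballFinset Δ (m + 1) = ballFinset Δ m ∪ level Δ (m + 1) := by
  ext v; simp; omega

lemma prod_ballFinset_succ {M : Type*} [CommMonoid M] (m : ℕ) (f : List (Fin Δ) → M) :
    ∏ v ∈ ballFinset Δ (m + 1), f v =
      (∏ v ∈ ballFinset Δ m, f v) * ∏ w ∈ level Δ (m + 1), f w := by
  rw [ballFinset_succ, Finset.prod_union]
  rw [Finset.disjoint_left]
  intro v; simp; omega

/-- The configurations that agree with `η` on the ball of radius `m`. -/
def ballCyl (m : ℕ) (η : List (Fin Δ) → Fin k) : Set (List (Fin Δ) → Fin k) :=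
  {σ | ∀ v ∈ ballFinset Δ m, σ v = η v}

lemma measurableSet_cyl (S : Finset (List (Fin Δ))) (η : List (Fin Δ) → Fin k) :
    MeasurableSet {σ : List (Fin Δ) → Fin k | ∀ v ∈ S, σ v = η v} := by
  have : {σ : List (Fin Δ) → Fin k | ∀ v ∈ S, σ v = η v} = ⋂ v ∈ S, {σ | σ v = η v} := by
    ext; simp
  rw [this]
  exact S.measurableSet_biInter fun v _ =>
    measurableSet_eq_fun (measurable_pi_apply v) measurable_const

lemma measurableSet_ballCyl (m : ℕ) (η : List (Fin Δ) → Fin k) : MeasurableSet (ballCyl m η) :=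
  measurableSet_cyl _ η

/-- Two finite measures that agree on all large enough balls are equal. -/
lemma measure_ext_of_ballCyl {μ ν : Measure (List (Fin Δ) → Fin k)} [IsFiniteMeasure μ]
    (m₀ : ℕ) (h : ∀ m, m₀ ≤ m → ∀ η, μ (ballCyl m η) = ν (ballCyl m η)) : μ = ν := by
  rcases isEmpty_or_nonempty (Fin k) with hk | hk
  · have : IsEmpty (List (Fin Δ) → Fin k) := ⟨fun f => hk.elim (f [])⟩
    exact Measure.ext fun s _ => by simp [Set.eq_empty_of_isEmpty s]
  have hball : ∀ m, m₀ ≤ m → μ.map (ballFinset Δ m).restrict = ν.map (ballFinset Δ m).restrict := by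
    intro m hm
    refine Measure.ext_of_singleton fun ζ => ?_
    have hmeas : Measurable ((ballFinset Δ m).restrict : (List (Fin Δ) → Fin k) → _) :=
      Finset.measurable_restrict _
    rw [Measure.map_apply hmeas (measurableSet_singleton _),
      Measure.map_apply hmeas (measurableSet_singleton _)]
    have : ((ballFinset Δ m).restrict : (List (Fin Δ) → Fin k) → _) ⁻¹' {ζ} = ballCyl m
        (fun v => if hv : v ∈ ballFinset Δ m then ζ ⟨v, hv⟩ else Classical.arbitrary _) := by
      ext σ
      simp only [Set.mem_preimage, Set.mem_singleton_iff, funext_iff, ballCyl, Set.mem_ofPred_eq,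
        Finset.restrict, Subtype.forall]
      exact forall₂_congr fun v hv => by rw [dif_pos hv]
    rw [this, h m hm]
  refine IsProjectiveLimit.unique (P := fun I => μ.map I.restrict) (fun I => rfl) fun I => ?_
  obtain ⟨m, hm₀, hm⟩ : ∃ m, m₀ ≤ m ∧ I ⊆ ballFinset Δ m := by
    refine ⟨max m₀ (I.sup List.length), le_max_left _ _, fun v hv => ?_⟩
    rw [mem_ballFinset]
    exact (Finset.le_sup (f := List.length) hv).trans (le_max_right _ _)
  have hm' := congrArg (Measure.map (Finset.restrict₂ (π := fun _ => Fin k) hm)) (hball m hm₀)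
  rw [Measure.map_map (Finset.measurable_restrict₂ _) (Finset.measurable_restrict _),
    Measure.map_map (Finset.measurable_restrict₂ _) (Finset.measurable_restrict _)] at hm'
  exact hm'.symm

/-- A probability measure that is constant on `S` and vanishes off `S` is uniform on `S`. -/
lemma eq_uniformOn_of_singleton {Ω : Type*} [Finite Ω] [MeasurableSpace Ω]
    [MeasurableSingletonClass Ω] {ν : Measure Ω} [IsProbabilityMeasure ν] {S : Set Ω} {C : ℝ≥0∞}
    (hS : ∀ x ∈ S, ν {x} = C) (hS' : ∀ x ∉ S, ν {x} = 0) : ν = uniformOn S := by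
  classical
  have := Fintype.ofFinite Ω
  have hsum : ∀ A : Set Ω, ν A = C * Measure.count (S ∩ A) := by
    intro A
    have h1 : ν A = ∑ x ∈ A.toFinset, ν {x} := by
      rw [sum_measure_singleton, Set.coe_toFinset]
    have h2 : Measure.count (S ∩ A) = ((S ∩ A).toFinset.card : ℝ≥0∞) := by
      conv_lhs => rw [← Set.coe_toFinset (S ∩ A)]
      rw [Measure.count_apply_finset]
    rw [h1, h2]
    have h3 : ∀ x ∈ A.toFinset, ν {x} = if x ∈ S then C else 0 := by
      intro x _
      split_ifs with h
      · exact hS x h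
      · exact hS' x h
    rw [Finset.sum_congr rfl h3, ← Finset.sum_filter, Finset.sum_const, nsmul_eq_mul, mul_comm]
    congr 3
    ext x; simp [and_comm]
  have h1 := hsum Set.univ
  rw [measure_univ, Set.inter_univ] at h1
  have hC : C = (Measure.count S)⁻¹ := ENNReal.eq_inv_of_mul_eq_one_left h1.symm
  ext A hA
  rw [hsum, uniformOn, cond_apply S.toFinite.measurableSet, hC]


lemma mem_colorings_finTree {ℓ : ℕ} (σ : ball Δ ℓ → Fin k) : σ ∈ colorings (finTree Δ ℓ) k ↔
    ∀ (a : Fin Δ) (v : List (Fin Δ)) (h : (a :: v).length ≤ ℓ),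
      σ ⟨a :: v, h⟩ ≠ σ ⟨v, (Nat.le_succ _).trans h⟩ := by
  constructor
  · intro h a v hv
    exact h _ _ (Or.inr ⟨a, rfl⟩)
  · rintro h ⟨v, hv⟩ ⟨w, hw⟩ (⟨a, ha⟩ | ⟨a, ha⟩)
    · simp only [Function.Embedding.subtype_apply] at ha
      subst ha
      exact (h a v hw).symm
    · simp only [Function.Embedding.subtype_apply] at ha
      subst ha
      exact h a w hv

instance (ℓ : ℕ) : Finite (ball Δ ℓ) := (List.finite_length_le (Fin Δ) ℓ).to_subtype

/-- The restriction of a configuration to a ball. -/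
def restrictBall (ℓ : ℕ) (σ : List (Fin Δ) → Fin k) (v : ball Δ ℓ) : Fin k := σ v.1

lemma measurable_restrictBall (ℓ : ℕ) :
    Measurable (restrictBall ℓ : (List (Fin Δ) → Fin k) → ball Δ ℓ → Fin k) :=
  measurable_pi_iff.2 fun v => measurable_pi_apply v.1

/-! ### Broadcasting as a product measure on increments -/

/-- The configuration with root color `ω []` and increments `ω` along the edges. -/
def decode (ω : List (Fin Δ) → Fin k) : List (Fin Δ) → Fin k
  | [] => ω []
  | a :: v => decode ω v + ω (a :: v)

/-- The root color and the increments of a configuration. -/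
def encode (σ : List (Fin Δ) → Fin k) : List (Fin Δ) → Fin k
  | [] => σ []
  | a :: v => σ (a :: v) - σ v

lemma measurable_decode : Measurable (decode : (List (Fin Δ) → Fin k) → _) := by
  refine measurable_pi_iff.2 fun v => ?_
  induction v with
  | nil => exact measurable_pi_apply []
  | cons a v ih =>
    exact (measurable_of_finite fun p : Fin k × Fin k => p.1 + p.2).comp
      (ih.prodMk (measurable_pi_apply (a :: v)))

variable [NeZero k]

/-- Balls are closed under taking parents, so a ball cylinder becomes a product set in the
increments, taken in the cyclic group `Fin k`. An edge is properly colored exactly when its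
increment is nonzero. -/
lemma decode_mem_ballCyl (m : ℕ) (ω η : List (Fin Δ) → Fin k) :
    decode ω ∈ ballCyl m η ↔ ∀ v ∈ ballFinset Δ m, ω v = encode η v := by
  simp only [ballCyl, Set.mem_ofPred_eq, mem_ballFinset]
  constructor
  · intro h v hv
    cases v with
    | nil => exact h [] hv
    | cons a v =>
      have h1 := h (a :: v) hv
      rw [decode, h v (by simp at hv; omega)] at h1
      rw [encode, ← h1, add_sub_cancel_left]
  · intro h v
    induction v with
    | nil => exact fun hv => h [] hv
    | cons a v ih =>
      intro hv
      rw [decode, ih (by simp at hv; omega), h _ hv, encode, add_sub_cancel]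

variable (k) in
/-- The law of the root color and of the increments: uniform on all colors, and on the nonzero
colors, respectively. -/
def noiseLaw (v : List (Fin Δ)) : Measure (Fin k) :=
  if v = [] then uniformOn Set.univ else uniformOn {0}ᶜ

instance [Nontrivial (Fin k)] (v : List (Fin Δ)) : IsProbabilityMeasure (noiseLaw k v) := by
  unfold noiseLaw
  split_ifs
  · infer_instance
  · exact isProbabilityMeasure_uniformOn (Set.toFinite _)
      ((exists_ne (0 : Fin k)).imp fun _ h => h)

variable (k) in
/-- The weight of an allowed value of the noise. -/
def noiseWeight (v : List (Fin Δ)) : ℝ≥0∞ := if v = [] then (k : ℝ≥0∞)⁻¹ else ((k : ℝ≥0∞) - 1)⁻¹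

lemma noiseLaw_singleton (v : List (Fin Δ)) (x : Fin k) :
    noiseLaw k v {x} = if v ≠ [] ∧ x = 0 then 0 else noiseWeight k v := by
  classical
  have hcompl : (Measure.count ({0}ᶜ : Set (Fin k))) = (k : ℝ≥0∞) - 1 := by
    have : ({0}ᶜ : Set (Fin k)) = ((Finset.univ.erase 0 : Finset (Fin k)) : Set (Fin k)) := by
      ext; simp
    rw [this, Measure.count_apply_finset, Finset.card_erase_of_mem (Finset.mem_univ _)]
    simp
  unfold noiseLaw noiseWeight
  by_cases hv : v = []
  · simp only [hv, if_true, ne_eq, not_true, false_and, if_false]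
    rw [uniformOn_univ]
    simp
  · simp only [hv, if_false, ne_eq, not_false_eq_true, true_and]
    rw [uniformOn, cond_apply (Set.toFinite _).measurableSet, hcompl]
    split_ifs with hx
    · simp [hx]
    · have : ({0}ᶜ : Set (Fin k)) ∩ {x} = {x} := by simpa using Ne.symm hx
      rw [this]; simp

lemma noiseWeight_cons (a : Fin Δ) (v : List (Fin Δ)) :
    (noiseWeight k (a :: v)).toReal = ((k : ℝ) - 1)⁻¹ := by
  rw [noiseWeight, if_neg (List.cons_ne_nil a v), ENNReal.toReal_inv,
    ENNReal.toReal_sub_of_le (by exact_mod_cast NeZero.one_le) (by simp)]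
  simp

variable [Nontrivial (Fin k)]

variable (Δ k) in
/-- The law of the coloring of the infinite tree obtained by broadcasting from the root. -/
def freeMeasure : Measure (List (Fin Δ) → Fin k) := (Measure.infinitePi (noiseLaw k)).map decode

instance : IsProbabilityMeasure (freeMeasure Δ k) :=
  Measure.isProbabilityMeasure_map measurable_decode.aemeasurable

lemma freeMeasure_ballCyl (m : ℕ) (η : List (Fin Δ) → Fin k) :
    freeMeasure Δ k (ballCyl m η) = ∏ v ∈ ballFinset Δ m, noiseLaw k v {encode η v} := by
  rw [freeMeasure, Measure.map_apply measurable_decode (measurableSet_ballCyl m η),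
    ← Measure.infinitePi_pi (μ := noiseLaw k) fun v _ => measurableSet_singleton (encode η v)]
  congr 1
  ext ω
  exact decode_mem_ballCyl m ω η

variable (Δ k) in
/-- The probability of any given proper coloring of the ball of radius `m`. -/
def ballWeight (m : ℕ) : ℝ≥0∞ := ∏ v ∈ ballFinset Δ m, noiseWeight k v

/-- The weight of an allowed increment does not depend on its value. This is why the broadcast law
is uniform on the proper colorings of a ball. -/
lemma freeMeasure_ballCyl_of_proper {m : ℕ} {η : List (Fin Δ) → Fin k}
    (h : ∀ a v, a :: v ∈ ballFinset Δ m → η (a :: v) ≠ η v) :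
    freeMeasure Δ k (ballCyl m η) = ballWeight Δ k m := by
  rw [freeMeasure_ballCyl, ballWeight]
  refine Finset.prod_congr rfl fun v hv => ?_
  rw [noiseLaw_singleton, if_neg]
  rintro ⟨hv0, hx⟩
  cases v with
  | nil => exact hv0 rfl
  | cons a v => exact h a v hv (sub_eq_zero.1 hx)

lemma freeMeasure_ballCyl_of_not_proper {m : ℕ} {η : List (Fin Δ) → Fin k}
    (h : ¬ ∀ a v, a :: v ∈ ballFinset Δ m → η (a :: v) ≠ η v) :
    freeMeasure Δ k (ballCyl m η) = 0 := by
  push Not at h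
  obtain ⟨a, v, hv, hη⟩ := h
  rw [freeMeasure_ballCyl]
  refine Finset.prod_eq_zero hv ?_
  rw [noiseLaw_singleton, if_pos]
  exact ⟨List.cons_ne_nil a v, sub_eq_zero.2 hη⟩

lemma freeMeasure_real_ballCyl_succ (m : ℕ) (η : List (Fin Δ) → Fin k) :
    (freeMeasure Δ k).real (ballCyl (m + 1) η) = (freeMeasure Δ k).real (ballCyl m η) *
      ∏ v ∈ level Δ m, ∏ a, if η (a :: v) = η v then 0 else ((k : ℝ) - 1)⁻¹ := by
  rw [measureReal_def, freeMeasure_ballCyl, prod_ballFinset_succ, ENNReal.toReal_mul,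
    ← freeMeasure_ballCyl, ← measureReal_def, prod_level_succ]
  congr 1
  rw [ENNReal.toReal_prod]
  refine Finset.prod_congr rfl fun v _ => ?_
  rw [ENNReal.toReal_prod]
  refine Finset.prod_congr rfl fun a _ => ?_
  rw [noiseLaw_singleton]
  simp only [encode, sub_eq_zero, ne_eq, reduceCtorEq, not_false_eq_true, true_and]
  split_ifs
  · rfl
  · exact noiseWeight_cons a v

/-- The uniform measure on the colorings of the finite tree is a marginal of the free measure. -/
theorem mu_eq_map (ℓ : ℕ) : mu Δ k ℓ = (freeMeasure Δ k).map (restrictBall ℓ) := by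
  have : IsProbabilityMeasure ((freeMeasure Δ k).map (restrictBall ℓ)) :=
    Measure.isProbabilityMeasure_map (measurable_restrictBall ℓ).aemeasurable
  have hsingle : ∀ x : ball Δ ℓ → Fin k, (freeMeasure Δ k).map (restrictBall ℓ) {x} =
      freeMeasure Δ k (ballCyl ℓ fun v => if h : v.length ≤ ℓ then x ⟨v, h⟩ else 0) := by
    intro x
    rw [Measure.map_apply (measurable_restrictBall ℓ) (measurableSet_singleton x)]
    congr 1
    ext σ
    simp only [Set.mem_preimage, Set.mem_singleton_iff, funext_iff, ballCyl, Set.mem_ofPred_eq,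
      restrictBall, Subtype.forall, mem_ballFinset]
    exact forall₂_congr fun v hv => by rw [dif_pos hv]
  have hproper : ∀ x : ball Δ ℓ → Fin k, x ∈ colorings (finTree Δ ℓ) k ↔
      ∀ (a : Fin Δ) (v : List (Fin Δ)), a :: v ∈ ballFinset Δ ℓ →
        (if h : (a :: v).length ≤ ℓ then x ⟨a :: v, h⟩ else 0) ≠
          if h : v.length ≤ ℓ then x ⟨v, h⟩ else 0 := by
    intro x
    rw [mem_colorings_finTree]
    refine forall₂_congr fun a v => ?_
    rw [mem_ballFinset]
    refine forall_congr' fun h => ?_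
    rw [dif_pos h, dif_pos ((Nat.le_succ _).trans h)]
  refine (eq_uniformOn_of_singleton (C := ballWeight Δ k ℓ) ?_ ?_).symm
  · intro x hx
    rw [hsingle, freeMeasure_ballCyl_of_proper ((hproper x).1 hx)]
  · intro x hx
    rw [hsingle, freeMeasure_ballCyl_of_not_proper fun h => hx ((hproper x).2 h)]

/-- The μ_ℓ are consistent marginals, so each cylinder probability is constant once ℓ reaches the
depth of its support. -/
theorem isFreeBoundaryMeasure_freeMeasure : IsFreeBoundaryMeasure Δ k (freeMeasure Δ k) := by
  refine ⟨inferInstance, fun S η => ?_⟩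
  refine tendsto_const_nhds.congr' ?_
  filter_upwards [eventually_ge_atTop (S.sup List.length)] with ℓ hℓ
  rw [mu_eq_map, Measure.map_apply (measurable_restrictBall ℓ) (Set.toFinite _).measurableSet]
  congr 1
  ext σ
  simp only [Set.mem_preimage, Set.mem_ofPred_eq, restrictBall, Subtype.forall]
  refine forall_congr' fun v => ⟨fun h _ hv => h hv, fun h hv => h ?_ hv⟩
  exact (Finset.le_sup (f := List.length) hv).trans hℓ

theorem IsFreeBoundaryMeasure.eq_freeMeasure {μ : Measure (List (Fin Δ) → Fin k)}
    (hμ : IsFreeBoundaryMeasure Δ k μ) : μ = freeMeasure Δ k := by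
  have := hμ.1
  refine measure_ext_of_ballCyl 0 fun m _ η => ?_
  exact tendsto_nhds_unique (hμ.2 (ballFinset Δ m) η)
    (isFreeBoundaryMeasure_freeMeasure.2 (ballFinset Δ m) η)

end Free

/-! ### The law of the boundary under the free measure -/

section BoundaryLaw

variable {Δ k : ℕ}

/-- The coloring of the leaves of the tree of depth `n` below `v`. -/
def leafColoring : ∀ n, List (Fin Δ) → (List (Fin Δ) → Fin k) → Boundary Δ k n
  | 0, v, σ => σ v
  | n + 1, v, σ => fun a => leafColoring n (a :: v) σ

lemma leafColoring_eq_iff (n : ℕ) (v : List (Fin Δ)) (σ τ : List (Fin Δ) → Fin k) :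
    leafColoring n v σ = leafColoring n v τ ↔
      ∀ w : List (Fin Δ), w.length = n → σ (w ++ v) = τ (w ++ v) := by
  induction n generalizing v with
  | zero =>
    simp only [List.length_eq_zero_iff, forall_eq, List.nil_append]
    exact Iff.rfl
  | succ n ih =>
    have h : leafColoring (n + 1) v σ = leafColoring (n + 1) v τ ↔
        ∀ a, leafColoring n (a :: v) σ = leafColoring n (a :: v) τ := funext_iff
    rw [h]
    simp only [ih]
    constructor
    · intro h w hw
      have hw0 : w ≠ [] := by rintro rfl; simp at hw
      -- Words list the last choice first, so the child of `v` through which the path passes is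
      -- given by the last letter of `w`.
      have h1 := h (w.getLast hw0) w.dropLast (by simp [hw])
      rwa [List.append_cons, List.dropLast_append_getLast] at h1
    · intro h a w hw
      have := h (w ++ [a]) (by simp [hw])
      simpa using this

instance (n : ℕ) : MeasurableSpace (Boundary Δ k n) := ⊤

instance (n : ℕ) : DiscreteMeasurableSpace (Boundary Δ k n) := ⟨fun _ => trivial⟩

lemma measurableSet_leafColoring_eq (n : ℕ) (v : List (Fin Δ)) (b : Boundary Δ k n) :
    MeasurableSet {σ : List (Fin Δ) → Fin k | leafColoring n v σ = b} := by
  induction n generalizing v with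
  | zero =>
    exact measurableSet_eq_fun (f := fun σ : List (Fin Δ) → Fin k => σ v) (g := fun _ => b)
      (measurable_pi_apply v) measurable_const
  | succ n ih =>
    have : {σ : List (Fin Δ) → Fin k | leafColoring (n + 1) v σ = b} =
        ⋂ a, {σ | leafColoring n (a :: v) σ = b a} := by
      ext σ
      rw [Set.mem_iInter]
      exact funext_iff
    rw [this]
    exact MeasurableSet.iInter fun a => ih _ _

lemma measurable_leafColoring (n : ℕ) (v : List (Fin Δ)) :
    Measurable (leafColoring n v : (List (Fin Δ) → Fin k) → Boundary Δ k n) :=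
  measurable_to_countable' fun b => measurableSet_leafColoring_eq n v b

lemma measureReal_eq_sum_inter_preimage {Ω ι : Type*} [MeasurableSpace Ω] [Fintype ι]
    (μ : Measure Ω) [IsFiniteMeasure μ] {f : Ω → ι} (hf : ∀ i, MeasurableSet (f ⁻¹' {i}))
    (E : Set Ω) : μ.real E = ∑ i, μ.real (E ∩ f ⁻¹' {i}) := by
  have h := sum_measureReal_preimage_singleton (μ := μ.restrict E) Finset.univ
    fun i _ => hf i
  simp only [Finset.coe_univ, Set.preimage_univ, measureReal_restrict_apply MeasurableSet.univ,
    Set.univ_inter] at h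
  rw [← h]
  refine Finset.sum_congr rfl fun i _ => ?_
  rw [measureReal_restrict_apply (hf i), Set.inter_comm]

/-- The recursion through the transition matrix of the broadcast, the form matched by
`freeMeasure_real_ballCyl_succ`. -/
lemma lik_succ (n : ℕ) (c : Fin k) (b : Boundary Δ k (n + 1)) :
    lik (n + 1) c b = ∏ a, ∑ c', (if c' = c then 0 else ((k : ℝ) - 1)⁻¹) * lik n c' (b a) := by
  change ∏ a, (∑ c', lik n c' (b a) - lik n c (b a)) / ((k : ℝ) - 1) = _
  refine Finset.prod_congr rfl fun a _ => ?_
  have : ∀ c', (if c' = c then 0 else ((k : ℝ) - 1)⁻¹) * lik n c' (b a) =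
      ((k : ℝ) - 1)⁻¹ * (lik n c' (b a) - if c' = c then lik n c' (b a) else 0) := by
    intro c'; split_ifs <;> ring
  simp only [this, ← Finset.mul_sum, Finset.sum_sub_distrib]
  rw [Finset.sum_ite_eq' Finset.univ c]
  simp only [Finset.mem_univ, if_true]
  ring

lemma two_le_of_nontrivial {k : ℕ} [Nontrivial (Fin k)] : 2 ≤ k := Fin.nontrivial_iff_two_le.1 ‹_›

lemma sum_mul_abs_le_sqrt {ι : Type*} [Fintype ι] (w x : ι → ℝ) (hw : ∀ i, 0 ≤ w i)
    (hw1 : ∑ i, w i = 1) : ∑ i, w i * |x i| ≤ √(∑ i, w i * x i ^ 2) := by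
  refine Real.le_sqrt_of_sq_le ?_
  have h := Finset.sum_sq_le_sum_mul_sum_of_sq_le_mul Finset.univ (r := fun i => w i * |x i|)
    (f := w) (g := fun i => w i * x i ^ 2) (fun i _ => hw i)
    (fun i _ => mul_nonneg (hw i) (sq_nonneg _)) (fun i _ => le_of_eq (by rw [mul_pow, sq_abs]; ring))
  rwa [hw1, one_mul] at h

/-- Far leaf colorings below a family of vertices nearly decouple from the colors of these
vertices. -/
theorem sum_abs_prod_lik_sub_le {ι : Type*} [Fintype ι] [DecidableEq ι]
    [Nontrivial (Fin k)] (n : ℕ) (c : ι → Fin k) :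
    ∑ b : ι → Boundary Δ k n, |∏ i, lik n (c i) (b i) - ∏ i, avgLik (lik n) (b i)| ≤
      √((1 + rootInfo Δ k n) ^ Fintype.card ι - 1) := by
  have hk : 2 ≤ k := two_le_of_nontrivial
  have hch := isChannel_lik (Δ := Δ) hk n
  have hprod : ∀ g : ι → Boundary Δ k n → ℝ, ∑ b : ι → Boundary Δ k n, ∏ i, g i (b i) =
      ∏ i, ∑ x, g i x := by
    intro g
    have h := Finset.prod_univ_sum (fun _ : ι => (Finset.univ : Finset (Boundary Δ k n))) g
    rw [Fintype.piFinset_univ] at h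
    exact h.symm
  set w : (ι → Boundary Δ k n) → ℝ := fun b => ∏ i, avgLik (lik n) (b i) with hw
  set x : (ι → Boundary Δ k n) → ℝ := fun b => ∏ i, density (lik n) (c i) (b i) with hx
  have hw0 : ∀ b, 0 ≤ w b := fun b => Finset.prod_nonneg fun i _ => hch.avgLik_nonneg _
  have hw1 : ∑ b, w b = 1 := by
    rw [hw, hprod fun _ => avgLik (lik n)]
    exact Finset.prod_eq_one fun i _ => hch.sum_avgLik hk
  have hwx : ∑ b, w b * x b = 1 := by
    simp only [hw, hx, ← Finset.prod_mul_distrib]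
    rw [hprod fun i y => avgLik (lik n) y * density (lik n) (c i) y]
    exact Finset.prod_eq_one fun i _ => hch.sum_avgLik_mul_density hk _
  -- The second moment of a product density tensorizes, one factor 1 + D for each vertex.
  have hwxx : ∑ b, w b * (x b * x b) = (1 + rootInfo Δ k n) ^ Fintype.card ι := by
    simp only [hw, hx, ← Finset.prod_mul_distrib]
    rw [hprod fun i y => avgLik (lik n) y * (density (lik n) (c i) y * density (lik n) (c i) y)]
    simp only [← overlap_eq_sum_density, overlap_lik_self hk]
    simp
  have hterm : ∀ b : ι → Boundary Δ k n,
      |∏ i, lik n (c i) (b i) - ∏ i, avgLik (lik n) (b i)| = w b * |x b - 1| := by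
    intro b
    have h : ∏ i, lik n (c i) (b i) = w b * x b := by
      simp only [hw, hx]
      rw [← Finset.prod_mul_distrib]
      exact Finset.prod_congr rfl fun i _ => hch.eq_avgLik_mul_density hk _ _
    rw [h]
    change |w b * x b - w b| = _
    rw [← mul_sub_one, abs_mul, abs_of_nonneg (hw0 b)]
  simp only [hterm]
  refine (sum_mul_abs_le_sqrt w _ hw0 hw1).trans (Real.sqrt_le_sqrt (le_of_eq ?_))
  have h : ∀ b, w b * (x b - 1) ^ 2 = w b * (x b * x b) - 2 * (w b * x b) + w b :=
    fun b => by ring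
  simp only [h, Finset.sum_add_distrib, Finset.sum_sub_distrib, ← Finset.mul_sum]
  rw [hwxx, hwx, hw1]
  ring

variable [NeZero k] [Nontrivial (Fin k)]

/-- Given the colors of the ball of radius `m`, the leaf colorings below the vertices of depth `m`
are independent. -/
theorem freeMeasure_real_ballCyl_inter (n : ℕ) : ∀ (m : ℕ) (η : List (Fin Δ) → Fin k)
    (b : List (Fin Δ) → Boundary Δ k n),
    (freeMeasure Δ k).real (ballCyl m η ∩ {σ | ∀ v ∈ level Δ m, leafColoring n v σ = b v}) =
      (freeMeasure Δ k).real (ballCyl m η) * ∏ v ∈ level Δ m, lik n (η v) (b v) := by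
  classical
  induction n with
  | zero =>
    intro m η b
    by_cases h : ∀ v ∈ level Δ m, b v = η v
    · have h1 : ballCyl m η ∩ {σ | ∀ v ∈ level Δ m, leafColoring 0 v σ = b v} = ballCyl m η := by
        refine Set.inter_eq_left.2 fun σ hσ v hv => ?_
        rw [h v hv]
        exact hσ v (by simp at hv; simp [hv])
      have h2 : ∏ v ∈ level Δ m, lik 0 (η v) (b v) = 1 := by
        refine Finset.prod_eq_one fun v hv => ?_
        exact if_pos (h v hv)
      rw [h1, h2, mul_one]
    · push Not at h
      obtain ⟨v, hv, hb⟩ := h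
      have h1 : ballCyl m η ∩ {σ | ∀ v ∈ level Δ m, leafColoring 0 v σ = b v} = ∅ := by
        refine Set.eq_empty_of_forall_notMem fun σ hσ => hb ?_
        rw [← hσ.2 v hv]
        exact hσ.1 v (by simp at hv; simp [hv])
      rw [h1, Finset.prod_eq_zero hv (if_neg hb)]
      simp
  | succ n ih =>
    intro m η b
    let b' : List (Fin Δ) → Boundary Δ k n
      | [] => leafColoring n [] η
      | a :: v => b v a
    let ext : (level Δ (m + 1) → Fin k) → List (Fin Δ) → Fin k := fun ξ w =>
      if h : w ∈ level Δ (m + 1) then ξ ⟨w, h⟩ else η w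
    have hext : ∀ ξ (w : level Δ (m + 1)), ext ξ w = ξ w := fun ξ w => dif_pos w.2
    have hext' : ∀ ξ w, w ∈ ballFinset Δ m → ext ξ w = η w := fun ξ w hw =>
      dif_neg (by simp at hw ⊢; omega)
    -- Summing over the colors `ξ` of level m + 1 enlarges the ball by one, so the induction
    -- hypothesis applies to each term.
    rw [measureReal_eq_sum_inter_preimage (freeMeasure Δ k)
      (f := (level Δ (m + 1)).restrict) (fun ξ => Finset.measurable_restrict _
        (measurableSet_singleton ξ))]
    have hset : ∀ ξ : level Δ (m + 1) → Fin k,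
        (ballCyl m η ∩ {σ | ∀ v ∈ level Δ m, leafColoring (n + 1) v σ = b v}) ∩
          (level Δ (m + 1)).restrict ⁻¹' {ξ} =
        ballCyl (m + 1) (ext ξ) ∩ {σ | ∀ w ∈ level Δ (m + 1), leafColoring n w σ = b' w} := by
      intro ξ
      ext σ
      constructor
      · rintro ⟨⟨h1, h2⟩, h3⟩
        refine ⟨fun w hw => ?_, fun w hw => ?_⟩
        · rw [ballFinset_succ, Finset.mem_union] at hw
          rcases hw with hw | hw
          · rw [hext' ξ w hw]; exact h1 w hw
          · exact (congrFun h3 ⟨w, hw⟩).trans (hext ξ ⟨w, hw⟩).symm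
        · cases w with
          | nil => simp at hw
          | cons a v => exact congrFun (h2 v (by simpa using hw)) a
      · rintro ⟨h1, h2⟩
        refine ⟨⟨fun w hw => ?_, fun v hv => ?_⟩, ?_⟩
        · rw [← hext' ξ w hw]
          exact h1 w (by rw [ballFinset_succ]; exact Finset.mem_union_left _ hw)
        · exact funext fun a => h2 (a :: v) (by simpa using hv)
        · refine funext fun w => ?_
          rw [← hext ξ w]
          exact h1 w (by rw [ballFinset_succ]; exact Finset.mem_union_right _ w.2)
    have hcyl : ∀ ξ, ballCyl m (ext ξ) = ballCyl m η := by
      intro ξ; ext σ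
      exact forall₂_congr fun v hv => by rw [hext' ξ v hv]
    let g : List (Fin Δ) → Fin k → ℝ := fun w c =>
      (if c = η w.tail then 0 else ((k : ℝ) - 1)⁻¹) * lik n c (b' w)
    have hterm : ∀ ξ, (freeMeasure Δ k).real (ballCyl (m + 1) (ext ξ) ∩
          {σ | ∀ w ∈ level Δ (m + 1), leafColoring n w σ = b' w}) =
        (freeMeasure Δ k).real (ballCyl m η) * ∏ w : level Δ (m + 1), g w (ξ w) := by
      intro ξ
      rw [ih (m + 1), freeMeasure_real_ballCyl_succ, hcyl, mul_assoc]
      congr 1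
      have h1 : ∏ w : level Δ (m + 1), g w (ξ w) = ∏ w ∈ level Δ (m + 1), g w (ext ξ w) := by
        rw [← Finset.prod_coe_sort (level Δ (m + 1)) fun w => g w (ext ξ w)]
        simp only [hext]
      rw [h1]
      simp only [g, Finset.prod_mul_distrib]
      congr 1
      rw [prod_level_succ]
      refine Finset.prod_congr rfl fun v hv => Finset.prod_congr rfl fun a _ => ?_
      rw [hext' ξ v (by simp at hv; simp [hv]), List.tail_cons]
    simp only [hset, hterm, ← Finset.mul_sum]
    congr 1
    -- Each summand is a product over level m + 1, so the sum over `ξ` factors into one sum per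
    -- vertex, which is the recursion of `lik_succ`.
    have h2 := Finset.prod_univ_sum (fun _ : level Δ (m + 1) => (Finset.univ : Finset (Fin k)))
      (fun w c => g w c)
    rw [Fintype.piFinset_univ] at h2
    rw [← h2, Finset.prod_coe_sort (level Δ (m + 1)) (fun w => ∑ c, g w c), prod_level_succ]
    refine Finset.prod_congr rfl fun v _ => ?_
    rw [lik_succ]
    rfl

/-! ### The expected bias of the root -/

lemma freeMeasure_real_root_leafColoring (n : ℕ) (c : Fin k) (b : Boundary Δ k n) :
    (freeMeasure Δ k).real ({σ | σ [] = c} ∩ {σ | leafColoring n [] σ = b}) = lik n c b / k := by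
  have h := freeMeasure_real_ballCyl_inter (Δ := Δ) n 0 (fun _ => c) (fun _ => b)
  have h0 : level Δ 0 = {[]} := by ext v; simp
  have h1 : ballFinset Δ 0 = {[]} := by ext v; simp
  have h2 : ballCyl 0 (fun _ => c) = {σ : List (Fin Δ) → Fin k | σ [] = c} := by
    simp [ballCyl, h1]
  have h3 : (freeMeasure Δ k).real {σ : List (Fin Δ) → Fin k | σ [] = c} = (k : ℝ)⁻¹ := by
    rw [← h2, measureReal_def, freeMeasure_ballCyl, h1, Finset.prod_singleton,
      noiseLaw_singleton, if_neg (by simp), noiseWeight, if_pos rfl]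
    simp
  rw [h2, h0, Finset.prod_singleton, h3] at h
  simp only [Finset.mem_singleton, forall_eq] at h
  rw [h, mul_comm, div_eq_mul_inv]

lemma freeMeasure_real_leafColoring (n : ℕ) (b : Boundary Δ k n) :
    (freeMeasure Δ k).real {σ | leafColoring n [] σ = b} = avgLik (lik n) b := by
  rw [measureReal_eq_sum_inter_preimage (freeMeasure Δ k) (f := fun σ => σ [])
    (fun c => measurable_pi_apply [] (measurableSet_singleton c)), avgLik, Finset.sum_div]
  refine Finset.sum_congr rfl fun c _ => ?_
  rw [← freeMeasure_real_root_leafColoring, Set.inter_comm]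
  rfl

/-- Bayes' rule with a uniform prior on the root color. For a leaf coloring of probability zero both
sides are 0 by convention. -/
lemma rootMarginal_restrictBall (n : ℕ) (τ : List (Fin Δ) → Fin k) (c : Fin k) :
    rootMarginal Δ k n (restrictBall n τ) c = density (lik n) c (leafColoring n [] τ) / k := by
  have hE : restrictBall n ⁻¹' {σ : ball Δ n → Fin k | ∀ v ∈ leaves Δ n, σ v = restrictBall n τ v} =
      {σ | leafColoring n [] σ = leafColoring n [] τ} := by
    ext σ
    simp only [Set.mem_preimage, Set.mem_ofPred_eq, leafColoring_eq_iff, leaves, restrictBall,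
      Subtype.forall, List.append_nil]
    exact ⟨fun h w hw => h w hw.le hw, fun h w _ hw => h w hw⟩
  have hmu : ∀ A : Set (ball Δ n → Fin k), (mu Δ k n) A = freeMeasure Δ k (restrictBall n ⁻¹' A) :=
    fun A => by
      rw [mu_eq_map, Measure.map_apply (measurable_restrictBall n) A.toFinite.measurableSet]
  rw [rootMarginal, measureReal_def, cond_apply (Set.toFinite _).measurableSet, hmu, hmu,
    Set.preimage_inter, hE, ENNReal.toReal_mul, ENNReal.toReal_inv, ← measureReal_def,
    ← measureReal_def, freeMeasure_real_leafColoring, Set.inter_comm]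
  have h := freeMeasure_real_root_leafColoring n c (leafColoring n [] τ)
  change _ * (freeMeasure Δ k).real ({σ | σ [] = c} ∩ _) = _
  rw [h, density]
  ring

/-- The posterior minus 1/k is (density - 1)/k, and the second moment of density - 1 under the leaf
law is `rootInfo`; Cauchy–Schwarz bounds the first moment. -/
theorem expectedBias_le (n : ℕ) (c : Fin k) :
    expectedBias Δ k n c ≤ √(rootInfo Δ k n) / k := by
  have hk : 2 ≤ k := two_le_of_nontrivial
  have hch := isChannel_lik (Δ := Δ) hk n
  have hmeas := measurable_leafColoring (k := k) n ([] : List (Fin Δ))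
  rw [expectedBias, mu_eq_map, integral_map (measurable_restrictBall n).aemeasurable
    (measurable_of_finite _).aestronglyMeasurable]
  simp only [rootMarginal_restrictBall]
  have h1 := integral_map (μ := freeMeasure Δ k) hmeas.aemeasurable
    (f := fun b => |density (lik n) c b / k - 1 / (k : ℝ)|)
    (Measurable.of_discrete).aestronglyMeasurable
  have : IsProbabilityMeasure ((freeMeasure Δ k).map (leafColoring n ([] : List (Fin Δ)))) :=
    Measure.isProbabilityMeasure_map hmeas.aemeasurable
  rw [← h1, integral_fintype .of_finite]
  have h2 : ∀ b : Boundary Δ k n,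
      ((freeMeasure Δ k).map (leafColoring n [])).real {b} • |density (lik n) c b / k - 1 / (k : ℝ)|
        = avgLik (lik n) b * |density (lik n) c b - 1| / k := by
    intro b
    rw [map_measureReal_apply hmeas (measurableSet_singleton b)]
    change (freeMeasure Δ k).real {σ | leafColoring n [] σ = b} • _ = _
    rw [freeMeasure_real_leafColoring, ← sub_div, abs_div, Nat.abs_cast, smul_eq_mul, mul_div_assoc]
  simp only [h2]
  rw [← Finset.sum_div]
  gcongr
  refine (sum_mul_abs_le_sqrt _ _ hch.avgLik_nonneg (hch.sum_avgLik hk)).trans (le_of_eq ?_)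
  rw [← hch.overlap_self_sub_one hk, overlap_lik_self hk, add_sub_cancel_left]


end BoundaryLaw

/-! ### The free measure is a Gibbs measure -/

section Gibbs

variable {Δ k : ℕ}

/-- The configuration `τ` with its values on `Λ` replaced by `η`. -/
def patch (Λ : Finset (List (Fin Δ))) (τ : List (Fin Δ) → Fin k) (η : Λ → Fin k)
    (v : List (Fin Δ)) : Fin k :=
  if h : v ∈ Λ then η ⟨v, h⟩ else τ v

lemma patch_of_mem {Λ : Finset (List (Fin Δ))} (τ : List (Fin Δ) → Fin k) (η : Λ → Fin k)
    {v : List (Fin Δ)} (h : v ∈ Λ) : patch Λ τ η v = η ⟨v, h⟩ := dif_pos h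

lemma patch_of_notMem {Λ : Finset (List (Fin Δ))} (τ : List (Fin Δ) → Fin k) (η : Λ → Fin k)
    {v : List (Fin Δ)} (h : v ∉ Λ) : patch Λ τ η v = τ v := dif_neg h

lemma patch_restrict (Λ : Finset (List (Fin Δ))) (τ : List (Fin Δ) → Fin k) :
    patch Λ τ (Λ.restrict τ) = τ := by
  funext v
  by_cases h : v ∈ Λ
  · exact patch_of_mem _ _ h
  · exact patch_of_notMem _ _ h

lemma restrict_patch (Λ : Finset (List (Fin Δ))) (τ : List (Fin Δ) → Fin k) (η : Λ → Fin k) :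
    Λ.restrict (patch Λ τ η) = η :=
  funext fun v => patch_of_mem τ η v.2

lemma patch_injective (Λ : Finset (List (Fin Δ))) (τ : List (Fin Δ) → Fin k) :
    Function.Injective (patch Λ τ) := fun η η' h => by
  rw [← restrict_patch Λ τ η, h, restrict_patch]

/-- The colorings of `Λ` that extend `τ` properly. -/
def fillings (Λ : Finset (List (Fin Δ))) (τ : List (Fin Δ) → Fin k) : Set (Λ → Fin k) :=
  {η | ∀ v ∈ Λ, ∀ w, (tree Δ).Adj v w → patch Λ τ η v ≠ patch Λ τ η w}

lemma mem_fillings {Λ : Finset (List (Fin Δ))} {τ : List (Fin Δ) → Fin k} {η : Λ → Fin k} :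
    η ∈ fillings Λ τ ↔ ∀ v ∈ Λ, ∀ w, (tree Δ).Adj v w → patch Λ τ η v ≠ patch Λ τ η w := Iff.rfl

lemma extensions_eq_image (Λ : Finset (List (Fin Δ))) (τ : List (Fin Δ) → Fin k) :
    extensions Δ k Λ τ = patch Λ τ '' fillings Λ τ := by
  ext ξ
  constructor
  · rintro ⟨h1, h2⟩
    have h : patch Λ τ (Λ.restrict ξ) = ξ := by
      funext v
      by_cases hv : v ∈ Λ
      · exact patch_of_mem _ _ hv
      · rw [patch_of_notMem _ _ hv, h1 v hv]
    refine ⟨Λ.restrict ξ, ?_, h⟩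
    rw [mem_fillings, h]
    exact h2
  · rintro ⟨η, hη, rfl⟩
    exact ⟨fun v hv => patch_of_notMem _ _ hv, hη⟩

/-- Moves the Gibbs kernel to the finite space `Λ → Fin k`, where it can be computed by counting. -/
lemma uniformOn_extensions (Λ : Finset (List (Fin Δ))) (τ : List (Fin Δ) → Fin k)
    (A : Set (List (Fin Δ) → Fin k)) :
    uniformOn (extensions Δ k Λ τ) A = uniformOn (fillings Λ τ) (patch Λ τ ⁻¹' A) := by
  rw [uniformOn, uniformOn, extensions_eq_image,
    cond_apply ((fillings Λ τ).toFinite.image _).measurableSet,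
    cond_apply (fillings Λ τ).toFinite.measurableSet, ← Set.image_inter_preimage,
    Measure.count_injective_image (patch_injective Λ τ),
    Measure.count_injective_image (patch_injective Λ τ)]

lemma measurable_patch (Λ : Finset (List (Fin Δ))) (η : Λ → Fin k) :
    Measurable fun τ => patch Λ τ η := by
  refine measurable_pi_iff.2 fun v => ?_
  by_cases h : v ∈ Λ
  · simp only [patch_of_mem _ _ h]; exact measurable_const
  · simp only [patch_of_notMem _ _ h]; exact measurable_pi_apply v

lemma measurableSet_mem_fillings (Λ : Finset (List (Fin Δ))) (η : Λ → Fin k) :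
    MeasurableSet {τ : List (Fin Δ) → Fin k | η ∈ fillings Λ τ} := by
  have : {τ : List (Fin Δ) → Fin k | η ∈ fillings Λ τ} =
      ⋂ v ∈ Λ, ⋂ w, ⋂ (_ : (tree Δ).Adj v w), {τ | patch Λ τ η v = patch Λ τ η w}ᶜ := by
    ext τ
    simp only [Set.mem_iInter]
    exact Iff.rfl
  rw [this]
  refine Finset.measurableSet_biInter _ fun v _ => MeasurableSet.iInter fun w =>
    MeasurableSet.iInter fun _ => (measurableSet_eq_fun ?_ ?_).compl
  · exact (measurable_pi_apply v).comp (measurable_patch Λ η)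
  · exact (measurable_pi_apply w).comp (measurable_patch Λ η)

lemma measurable_uniformOn_extensions (Λ : Finset (List (Fin Δ)))
    {A : Set (List (Fin Δ) → Fin k)} (hA : MeasurableSet A) :
    Measurable fun τ => uniformOn (extensions Δ k Λ τ) A := by
  classical
  have hcount : ∀ {T : (List (Fin Δ) → Fin k) → Set (Λ → Fin k)},
      (∀ η, MeasurableSet {τ | η ∈ T τ}) → Measurable fun τ => Measure.count (T τ) := by
    intro T hT
    have h : ∀ τ, Measure.count (T τ) = ∑ η, {τ | η ∈ T τ}.indicator (fun _ => (1 : ℝ≥0∞)) τ := by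
      intro τ
      have : Measure.count (T τ) = ((Finset.univ.filter (· ∈ T τ)).card : ℝ≥0∞) := by
        rw [← Measure.count_apply_finset]
        congr 1; ext; simp
      rw [this, Finset.card_filter, Nat.cast_sum]
      refine Finset.sum_congr rfl fun η _ => ?_
      simp only [Set.indicator_apply, Set.mem_ofPred_eq]
      split_ifs <;> simp
    simp only [h]
    exact Finset.measurable_sum _ fun η _ => measurable_const.indicator (hT η)
  have h : ∀ τ, uniformOn (extensions Δ k Λ τ) A =
      (Measure.count (fillings Λ τ))⁻¹ * Measure.count (fillings Λ τ ∩ patch Λ τ ⁻¹' A) := fun τ => by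
    rw [uniformOn_extensions, uniformOn, cond_apply (fillings Λ τ).toFinite.measurableSet]
  simp only [h]
  exact (hcount (measurableSet_mem_fillings Λ)).inv.mul (hcount fun η =>
    (measurableSet_mem_fillings Λ η).inter (measurable_patch Λ η hA))

/-- The Markov property: only the outer boundary of Λ matters. -/
lemma fillings_congr {Λ : Finset (List (Fin Δ))} {τ τ' : List (Fin Δ) → Fin k}
    (h : ∀ v ∈ Λ, ∀ w ∉ Λ, (tree Δ).Adj v w → τ w = τ' w) : fillings Λ τ = fillings Λ τ' := by
  ext η
  rw [mem_fillings, mem_fillings]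
  refine forall₄_congr fun v hv w hw => ?_
  rw [patch_of_mem _ _ hv, patch_of_mem _ _ hv]
  by_cases hwΛ : w ∈ Λ
  · rw [patch_of_mem _ _ hwΛ, patch_of_mem _ _ hwΛ]
  · rw [patch_of_notMem _ _ hwΛ, patch_of_notMem _ _ hwΛ, h v hv w hwΛ hw]

lemma length_le_of_adj {v w : List (Fin Δ)} (h : (tree Δ).Adj v w) : w.length ≤ v.length + 1 := by
  rcases h with ⟨a, rfl⟩ | ⟨a, rfl⟩ <;> simp; omega

variable [NeZero k] [Nontrivial (Fin k)]

/-- Among the configurations that agree with `η` off `Λ`, the free measure charges the proper ones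
equally. -/
lemma exists_freeMeasure_ballCyl_patch {Λ : Finset (List (Fin Δ))} {m : ℕ}
    (hΛ : ∀ v ∈ Λ, v.length < m) (η : List (Fin Δ) → Fin k) :
    ∃ W, (∀ ζ ∈ fillings Λ η, freeMeasure Δ k (ballCyl m (patch Λ η ζ)) = W) ∧
      ∀ ζ ∉ fillings Λ η, freeMeasure Δ k (ballCyl m (patch Λ η ζ)) = 0 := by
  have hfill : ∀ ζ, (∀ a v, a :: v ∈ ballFinset Δ m → patch Λ η ζ (a :: v) ≠ patch Λ η ζ v) →
      ζ ∈ fillings Λ η := by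
    rintro ζ h v hv w (⟨a, rfl⟩ | ⟨a, rfl⟩)
    · exact (h a v (by simpa using hΛ v hv)).symm
    · exact h a w (by simpa using (hΛ _ hv).le)
  -- If η violates an edge of the ball that misses Λ, no filling can repair it and all weights
  -- vanish; otherwise properness on the ball is decided by the filling alone.
  by_cases hout : ∀ a v, a :: v ∈ ballFinset Δ m → a :: v ∉ Λ → v ∉ Λ → η (a :: v) ≠ η v
  · refine ⟨ballWeight Δ k m, fun ζ hζ => freeMeasure_ballCyl_of_proper fun a v hav => ?_,
      fun ζ hζ => freeMeasure_ballCyl_of_not_proper fun h => hζ (hfill ζ h)⟩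
    by_cases h1 : a :: v ∈ Λ
    · exact hζ _ h1 v (Or.inr ⟨a, rfl⟩)
    by_cases h2 : v ∈ Λ
    · exact (hζ _ h2 (a :: v) (Or.inl ⟨a, rfl⟩)).symm
    rw [patch_of_notMem _ _ h1, patch_of_notMem _ _ h2]
    exact hout a v hav h1 h2
  · have h0 : ∀ ζ, freeMeasure Δ k (ballCyl m (patch Λ η ζ)) = 0 := by
      intro ζ
      refine freeMeasure_ballCyl_of_not_proper fun h => hout fun a v hav h1 h2 => ?_
      have := h a v hav
      rwa [patch_of_notMem _ _ h1, patch_of_notMem _ _ h2] at this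
    exact ⟨0, fun ζ _ => h0 ζ, fun ζ _ => h0 ζ⟩

/-- It suffices to test cylinders of balls that contain Λ and its neighbors, hence the + 1 in the
radius. There the kernel vanishes off the event `E` of agreement with η outside Λ, and on `E` it is
1/N or 0, with N the number of fillings. As `E` has mass N·W, the integral is the weight W or 0 of
the cylinder itself. -/
theorem freeMeasure_mem_gibbsMeasures : freeMeasure Δ k ∈ gibbsMeasures Δ k := by
  classical
  refine ⟨inferInstance, fun Λ A hA => ?_⟩
  have hκ : Measurable fun τ : List (Fin Δ) → Fin k => uniformOn (extensions Δ k Λ τ) :=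
    Measure.measurable_of_measurable_coe _ fun A hA => measurable_uniformOn_extensions Λ hA
  suffices h : freeMeasure Δ k =
      (freeMeasure Δ k).bind fun τ => uniformOn (extensions Δ k Λ τ) by
    conv_lhs => rw [h]
    exact Measure.bind_apply hA hκ.aemeasurable
  refine measure_ext_of_ballCyl (Λ.sup List.length + 1) fun m hm η => ?_
  have hΛ : ∀ v ∈ Λ, v.length < m := fun v hv =>
    (Nat.lt_succ_of_le (Finset.le_sup (f := List.length) hv)).trans_le hm
  rw [Measure.bind_apply (measurableSet_ballCyl m η) hκ.aemeasurable]
  obtain ⟨W, hW, hW0⟩ := exists_freeMeasure_ballCyl_patch hΛ η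
  set E : Set (List (Fin Δ) → Fin k) := {τ | ∀ v ∈ ballFinset Δ m \ Λ, τ v = η v} with hE
  have hEm : MeasurableSet E := measurableSet_cyl _ η
  have hpatch : ∀ τ ζ, patch Λ τ ζ ∈ ballCyl m η ↔ τ ∈ E ∧ ζ = Λ.restrict η := by
    intro τ ζ
    constructor
    · intro h
      refine ⟨fun v hv => ?_, funext fun v => ?_⟩
      · rw [Finset.mem_sdiff] at hv
        rw [← h v hv.1, patch_of_notMem _ _ hv.2]
      · rw [← patch_of_mem τ ζ v.2]
        exact h v (by simpa using (hΛ v v.2).le)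
    · rintro ⟨h1, rfl⟩ v hv
      by_cases hvΛ : v ∈ Λ
      · exact patch_of_mem _ _ hvΛ
      · rw [patch_of_notMem _ _ hvΛ]
        exact h1 v (Finset.mem_sdiff.2 ⟨hv, hvΛ⟩)
  have hker : ∀ τ, uniformOn (extensions Δ k Λ τ) (ballCyl m η) =
      E.indicator (fun _ => uniformOn (fillings Λ η) {Λ.restrict η}) τ := by
    intro τ
    rw [uniformOn_extensions]
    by_cases hτ : τ ∈ E
    · rw [Set.indicator_of_mem hτ]
      have h1 : patch Λ τ ⁻¹' ballCyl m η = {Λ.restrict η} := by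
        ext ζ
        rw [Set.mem_preimage, hpatch]
        exact and_iff_right hτ
      have h2 : fillings Λ τ = fillings Λ η := by
        refine fillings_congr fun v hv w hw hvw => hτ w ?_
        rw [Finset.mem_sdiff, mem_ballFinset]
        exact ⟨(length_le_of_adj hvw).trans (hΛ v hv), hw⟩
      rw [h1, h2]
    · rw [Set.indicator_of_notMem hτ]
      have h1 : patch Λ τ ⁻¹' ballCyl m η = ∅ := by
        ext ζ
        rw [Set.mem_preimage, hpatch]
        simp [hτ]
      rw [h1, measure_empty]
  have hEmeas : freeMeasure Δ k E = W * Measure.count (fillings Λ η) := by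
    have h1 := sum_measure_preimage_singleton (μ := (freeMeasure Δ k).restrict E)
      (f := (Λ.restrict : (List (Fin Δ) → Fin k) → _)) Finset.univ
      fun ζ _ => Finset.measurable_restrict _ (measurableSet_singleton ζ)
    simp only [Finset.coe_univ, Set.preimage_univ, Measure.restrict_apply MeasurableSet.univ,
      Set.univ_inter] at h1
    have h2 : ∀ ζ : Λ → Fin k, (freeMeasure Δ k).restrict E
        ((Λ.restrict : (List (Fin Δ) → Fin k) → _) ⁻¹' {ζ}) =
        if ζ ∈ fillings Λ η then W else 0 := by
      intro ζ
      rw [Measure.restrict_apply (Finset.measurable_restrict _ (measurableSet_singleton ζ))]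
      have h3 : (Λ.restrict : (List (Fin Δ) → Fin k) → _) ⁻¹' {ζ} ∩ E = ballCyl m (patch Λ η ζ) := by
        ext τ
        constructor
        · rintro ⟨h4, h5⟩ v hv
          by_cases hvΛ : v ∈ Λ
          · rw [patch_of_mem _ _ hvΛ]
            exact congrFun h4 ⟨v, hvΛ⟩
          · rw [patch_of_notMem _ _ hvΛ]
            exact h5 v (Finset.mem_sdiff.2 ⟨hv, hvΛ⟩)
        · intro h4
          refine ⟨funext fun v => ?_, fun v hv => ?_⟩
          · rw [← patch_of_mem η ζ v.2]
            exact h4 v (by simpa using (hΛ v v.2).le)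
          · rw [Finset.mem_sdiff] at hv
            rw [h4 v hv.1, patch_of_notMem _ _ hv.2]
      rw [h3]
      split_ifs with h
      · exact hW ζ h
      · exact hW0 ζ h
    rw [← h1]
    simp only [h2]
    rw [← Finset.sum_filter, Finset.sum_const, nsmul_eq_mul, mul_comm]
    congr 1
    rw [← Measure.count_apply_finset]
    congr 1; ext; simp
  simp only [hker]
  rw [lintegral_indicator hEm, setLIntegral_const, hEmeas, uniformOn,
    cond_apply (Set.toFinite _).measurableSet]
  have hη : ballCyl m η = ballCyl m (patch Λ η (Λ.restrict η)) := by rw [patch_restrict]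
  by_cases hr : Λ.restrict η ∈ fillings Λ η
  · rw [hη, hW _ hr, Set.inter_eq_right.2 (Set.singleton_subset_iff.2 hr),
      Measure.count_singleton, mul_one, mul_comm W, ← mul_assoc,
      ENNReal.inv_mul_cancel, one_mul]
    · exact Measure.count_ne_zero ⟨_, hr⟩
    · exact (Measure.count_apply_lt_top.2 (Set.toFinite _)).ne
  · rw [hη, hW0 _ hr, Set.inter_singleton_eq_empty.2 hr]
    simp

end Gibbs

/-! ### Extremality of the free measure -/

section Extremal

variable {Δ k : ℕ}

/-- The leaf colorings of the trees of depth `n` below the vertices of depth `m`. -/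
def levelColoring (m n : ℕ) (τ : List (Fin Δ) → Fin k) (v : level Δ m) : Boundary Δ k n :=
  leafColoring n v τ

lemma measurable_levelColoring (m n : ℕ) :
    Measurable (levelColoring m n : (List (Fin Δ) → Fin k) → level Δ m → Boundary Δ k n) :=
  measurable_pi_iff.2 fun v => measurable_leafColoring n v.1

lemma levelColoring_eq_iff (m n : ℕ) (σ τ : List (Fin Δ) → Fin k) :
    levelColoring m n σ = levelColoring m n τ ↔ ∀ w ∈ level Δ (m + n), σ w = τ w := by
  simp only [funext_iff, levelColoring, leafColoring_eq_iff, Subtype.forall, mem_level]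
  constructor
  · intro h w hw
    have := h (w.drop n) (by simp [hw]) (w.take n) (by simp [hw])
    rwa [List.take_append_drop] at this
  · intro h v hv w hw
    exact h _ (by simp [hv, hw, add_comm])

/-- The boundary sits at depth m + n + 1, just outside the resampled ball of radius m + n; this is
the source of the n + 1 below. -/
lemma levelColoring_patch (m n : ℕ) (τ : List (Fin Δ) → Fin k) (ζ : ballFinset Δ (m + n) → Fin k) :
    levelColoring m (n + 1) (patch (ballFinset Δ (m + n)) τ ζ) = levelColoring m (n + 1) τ := by
  rw [levelColoring_eq_iff]
  intro w hw
  refine patch_of_notMem _ _ ?_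
  simp at hw ⊢
  omega

/-- The conditional probability of a cylinder in a ball, given the configuration outside a larger
ball, depends only on the boundary of the larger ball. -/
lemma uniformOn_extensions_congr (m n : ℕ) (η : List (Fin Δ) → Fin k)
    {τ τ' : List (Fin Δ) → Fin k} (h : levelColoring m (n + 1) τ = levelColoring m (n + 1) τ') :
    uniformOn (extensions Δ k (ballFinset Δ (m + n)) τ) (ballCyl m η) =
      uniformOn (extensions Δ k (ballFinset Δ (m + n)) τ') (ballCyl m η) := by
  rw [uniformOn_extensions, uniformOn_extensions]
  have h1 : fillings (ballFinset Δ (m + n)) τ = fillings (ballFinset Δ (m + n)) τ' := by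
    refine fillings_congr fun v hv w hw hvw => (levelColoring_eq_iff _ _ _ _).1 h w ?_
    have := length_le_of_adj hvw
    simp at hv hw ⊢
    omega
  have h2 : patch (ballFinset Δ (m + n)) τ ⁻¹' ballCyl m η =
      patch (ballFinset Δ (m + n)) τ' ⁻¹' ballCyl m η := by
    ext ζ
    refine forall₂_congr fun v hv => ?_
    have : v ∈ ballFinset Δ (m + n) := by simp at hv ⊢; omega
    rw [patch_of_mem _ _ this, patch_of_mem _ _ this]
  rw [h1, h2]

variable [NeZero k] [Nontrivial (Fin k)]

lemma freeMeasure_real_ballCyl_inter_levelColoring (m n : ℕ) (η : List (Fin Δ) → Fin k)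
    (b : level Δ m → Boundary Δ k n) :
    (freeMeasure Δ k).real (ballCyl m η ∩ levelColoring m n ⁻¹' {b}) =
      (freeMeasure Δ k).real (ballCyl m η) * ∏ v : level Δ m, lik n (η v) (b v) := by
  have h := freeMeasure_real_ballCyl_inter n m η
    fun v => if hv : v ∈ level Δ m then b ⟨v, hv⟩ else leafColoring n v η
  have h1 : {σ : List (Fin Δ) → Fin k | ∀ v ∈ level Δ m, leafColoring n v σ =
      if hv : v ∈ level Δ m then b ⟨v, hv⟩ else leafColoring n v η} =
      levelColoring m n ⁻¹' {b} := by
    ext σ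
    simp only [Set.mem_preimage, Set.mem_singleton_iff, funext_iff, levelColoring, Subtype.forall,
      Set.mem_ofPred_eq]
    exact forall₂_congr fun v hv => by rw [dif_pos hv]
  rw [h1] at h
  rw [h, ← Finset.prod_coe_sort]
  congr 1
  exact Finset.prod_congr rfl fun v _ => by rw [dif_pos v.2]

/-- A cylinder in a ball is nearly independent of a far boundary. -/
theorem sum_abs_freeMeasure_real_inter_le (m n : ℕ) (η : List (Fin Δ) → Fin k) :
    ∑ b : level Δ m → Boundary Δ k n,
      |(freeMeasure Δ k).real (ballCyl m η ∩ levelColoring m n ⁻¹' {b}) -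
        (freeMeasure Δ k).real (ballCyl m η) * (freeMeasure Δ k).real (levelColoring m n ⁻¹' {b})| ≤
      2 * √((1 + rootInfo Δ k n) ^ (level Δ m).card - 1) := by
  set P := freeMeasure Δ k with hP
  set R := √((1 + rootInfo Δ k n) ^ (level Δ m).card - 1) with hR
  -- Both the conditional and the unconditional law of the far boundary are compared with the
  -- product law `ν`; the unconditional one is a mixture of the conditional ones, so each is within
  -- `R`, whence the factor 2.
  set ν : (level Δ m → Boundary Δ k n) → ℝ := fun b => ∏ v, avgLik (lik n) (b v) with hν
  have htv : ∀ c : level Δ m → Fin k, ∑ b : level Δ m → Boundary Δ k n,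
      |∏ v, lik n (c v) (b v) - ν b| ≤ R := fun c => by
    have h := sum_abs_prod_lik_sub_le (Δ := Δ) n c
    rwa [Fintype.card_coe] at h
  let ext : (ballFinset Δ m → Fin k) → List (Fin Δ) → Fin k := fun ζ => patch (ballFinset Δ m) η ζ
  have hpre : ∀ ζ, ((ballFinset Δ m).restrict : (List (Fin Δ) → Fin k) → _) ⁻¹' {ζ} =
      ballCyl m (ext ζ) := by
    intro ζ
    ext σ
    simp only [Set.mem_preimage, Set.mem_singleton_iff, funext_iff, ballCyl, Set.mem_ofPred_eq,
      Finset.restrict, Subtype.forall]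
    exact forall₂_congr fun v hv => by rw [← patch_of_mem η ζ hv]
  have hrestr : ∀ ζ, MeasurableSet
      (((ballFinset Δ m).restrict : (List (Fin Δ) → Fin k) → _) ⁻¹' {ζ}) := fun ζ =>
    Finset.measurable_restrict _ (measurableSet_singleton ζ)
  have hone : ∑ ζ, P.real (ballCyl m (ext ζ)) = 1 := by
    have h := measureReal_eq_sum_inter_preimage P hrestr Set.univ
    simp only [Set.univ_inter, hpre] at h
    rw [← h, probReal_univ]
  have hb : ∀ b, P.real (levelColoring m n ⁻¹' {b}) =
      ∑ ζ, P.real (ballCyl m (ext ζ)) * ∏ v : level Δ m, lik n (ext ζ v) (b v) := by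
    intro b
    rw [measureReal_eq_sum_inter_preimage P hrestr]
    refine Finset.sum_congr rfl fun ζ _ => ?_
    rw [hpre, Set.inter_comm, freeMeasure_real_ballCyl_inter_levelColoring]
  have hν_sub : ∀ b, |P.real (levelColoring m n ⁻¹' {b}) - ν b| ≤
      ∑ ζ, P.real (ballCyl m (ext ζ)) * |∏ v : level Δ m, lik n (ext ζ v) (b v) - ν b| := by
    intro b
    have h : P.real (levelColoring m n ⁻¹' {b}) - ν b =
        ∑ ζ, P.real (ballCyl m (ext ζ)) * (∏ v : level Δ m, lik n (ext ζ v) (b v) - ν b) := by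
      simp only [mul_sub, Finset.sum_sub_distrib, ← Finset.sum_mul]
      rw [hone, one_mul, hb]
    rw [h]
    refine (Finset.abs_sum_le_sum_abs _ _).trans (le_of_eq ?_)
    exact Finset.sum_congr rfl fun ζ _ => by rw [abs_mul, abs_of_nonneg measureReal_nonneg]
  have hsum : ∑ b, |P.real (levelColoring m n ⁻¹' {b}) - ν b| ≤ R := by
    refine (Finset.sum_le_sum fun b _ => hν_sub b).trans ?_
    rw [Finset.sum_comm]
    simp only [← Finset.mul_sum]
    calc _ ≤ ∑ ζ, P.real (ballCyl m (ext ζ)) * R := Finset.sum_le_sum fun ζ _ =>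
          mul_le_mul_of_nonneg_left (htv fun v => ext ζ v) measureReal_nonneg
      _ = R := by rw [← Finset.sum_mul, hone, one_mul]
  calc _ ≤ ∑ b, (|∏ v : level Δ m, lik n (η v) (b v) - ν b| +
        |P.real (levelColoring m n ⁻¹' {b}) - ν b|) := by
        refine Finset.sum_le_sum fun b _ => ?_
        rw [hP, freeMeasure_real_ballCyl_inter_levelColoring, ← mul_sub, abs_mul,
          abs_of_nonneg measureReal_nonneg]
        refine (mul_le_of_le_one_left (abs_nonneg _) measureReal_le_one).trans ?_
        refine (abs_sub_le _ (ν b) _).trans (le_of_eq ?_)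
        rw [abs_sub_comm (ν b)]
    _ ≤ R + R := by
        rw [Finset.sum_add_distrib]
        exact add_le_add (htv fun v => η v) hsum
    _ = 2 * R := by ring

/-- Under the free measure, the conditional probability of a cylinder given a far boundary is
nearly constant. -/
theorem integral_abs_uniformOn_extensions_sub_le (m n : ℕ) (η : List (Fin Δ) → Fin k) :
    ∫ τ, |(uniformOn (extensions Δ k (ballFinset Δ (m + n)) τ)).real (ballCyl m η) -
      (freeMeasure Δ k).real (ballCyl m η)| ∂(freeMeasure Δ k) ≤
      2 * √((1 + rootInfo Δ k (n + 1)) ^ (level Δ m).card - 1) := by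
  classical
  set P := freeMeasure Δ k with hP
  set F : (List (Fin Δ) → Fin k) → ℝ := fun τ =>
    (uniformOn (extensions Δ k (ballFinset Δ (m + n)) τ)).real (ballCyl m η) with hF
  set Φ : (List (Fin Δ) → Fin k) → level Δ m → Boundary Δ k (n + 1) := levelColoring m (n + 1)
    with hΦ
  have hΦm : Measurable Φ := measurable_levelColoring m (n + 1)
  have hfactor : Function.FactorsThrough F Φ := fun τ τ' h => by
    simp only [hF, measureReal_def]
    rw [uniformOn_extensions_congr m n η h]
  obtain ⟨G, hG⟩ : ∃ G : (level Δ m → Boundary Δ k (n + 1)) → ℝ, ∀ τ, F τ = G (Φ τ) :=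
    ⟨Function.extend Φ F fun _ => 0, fun τ => (hfactor.extend_apply _ τ).symm⟩
  -- The DLR equation for the cylinder intersected with a boundary event: resampling the ball leaves
  -- the boundary unchanged, so the kernel is `G b` on that event and 0 off it.
  have hinter : ∀ b, P.real (ballCyl m η ∩ Φ ⁻¹' {b}) = P.real (Φ ⁻¹' {b}) * G b := by
    intro b
    have hb : MeasurableSet (Φ ⁻¹' {b}) := hΦm (measurableSet_singleton b)
    have h := freeMeasure_mem_gibbsMeasures.2 (ballFinset Δ (m + n)) (ballCyl m η ∩ Φ ⁻¹' {b})
      ((measurableSet_ballCyl m η).inter hb)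
    have h1 : ∀ τ, uniformOn (extensions Δ k (ballFinset Δ (m + n)) τ) (ballCyl m η ∩ Φ ⁻¹' {b}) =
        (Φ ⁻¹' {b}).indicator (fun _ => ENNReal.ofReal (G b)) τ := by
      intro τ
      have h2 : patch (ballFinset Δ (m + n)) τ ⁻¹' (Φ ⁻¹' {b}) = {_ζ | Φ τ = b} := by
        ext ζ
        simp only [Set.mem_preimage, Set.mem_singleton_iff, hΦ, levelColoring_patch,
          Set.mem_ofPred_eq]
      rw [uniformOn_extensions, Set.preimage_inter, h2]
      by_cases hτ : Φ τ = b
      · rw [Set.indicator_of_mem (show τ ∈ Φ ⁻¹' {b} from hτ), ← hτ, ← hG]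
        simp only [Set.ofPred_true, Set.inter_univ]
        rw [← uniformOn_extensions, hF]
        exact (ofReal_measureReal (measure_ne_top _ _)).symm
      · rw [Set.indicator_of_notMem (show τ ∉ Φ ⁻¹' {b} from hτ)]
        simp [hτ]
    simp only [h1] at h
    rw [lintegral_indicator hb, setLIntegral_const] at h
    rw [measureReal_def, hP, h, ENNReal.toReal_mul, mul_comm]
    by_cases hne : ∃ τ, Φ τ = b
    · obtain ⟨τ, rfl⟩ := hne
      rw [ENNReal.toReal_ofReal (by rw [← hG]; exact measureReal_nonneg)]
      rfl
    · have : Φ ⁻¹' {b} = ∅ := Set.eq_empty_of_forall_notMem fun τ hτ => hne ⟨τ, hτ⟩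
      rw [this]; simp
  have hint := integral_map (μ := P) hΦm.aemeasurable
    (f := fun b => |G b - P.real (ballCyl m η)|) Measurable.of_discrete.aestronglyMeasurable
  have : IsProbabilityMeasure (P.map Φ) := Measure.isProbabilityMeasure_map hΦm.aemeasurable
  change ∫ τ, |F τ - P.real (ballCyl m η)| ∂P ≤ _
  simp only [hG]
  rw [← hint, integral_fintype .of_finite]
  refine le_trans (le_of_eq ?_) (sum_abs_freeMeasure_real_inter_le m (n + 1) η)
  refine Finset.sum_congr rfl fun b _ => ?_
  rw [map_measureReal_apply hΦm (measurableSet_singleton b)]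
  change _ = |P.real (ballCyl m η ∩ Φ ⁻¹' {b}) - P.real (ballCyl m η) * P.real (Φ ⁻¹' {b})|
  rw [hinter, mul_comm (P.real (ballCyl m η)), ← mul_sub, abs_mul, abs_of_nonneg measureReal_nonneg,
    smul_eq_mul]

/-- By the DLR equations, μ₁ of a cylinder is the μ₁-mean of its conditional probability `F n`. The
deviation of `F n` from the constant `p` is small in L¹ under the free measure, and a·μ₁ is
dominated by that measure. -/
theorem isExtremalGibbs_freeMeasure (h : Tendsto (rootInfo Δ k) atTop (𝓝 0)) :
    IsExtremalGibbs Δ k (freeMeasure Δ k) := by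
  refine ⟨freeMeasure_mem_gibbsMeasures, fun μ₁ hμ₁ μ₂ hμ₂ hseg => ?_⟩
  obtain ⟨a, b, ha, hb, -, hab⟩ := hseg
  have := hμ₁.1
  have := hμ₂.1
  refine measure_ext_of_ballCyl 0 fun m _ η => ?_
  set P := freeMeasure Δ k with hP
  set p := P.real (ballCyl m η) with hp
  let F : ℕ → (List (Fin Δ) → Fin k) → ℝ := fun n τ =>
    (uniformOn (extensions Δ k (ballFinset Δ (m + n)) τ)).real (ballCyl m η)
  have hFm : ∀ n, Measurable (F n) := fun n =>
    (measurable_uniformOn_extensions _ (measurableSet_ballCyl m η)).ennreal_toReal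
  have hF : ∀ n (Q : Measure (List (Fin Δ) → Fin k)) [IsFiniteMeasure Q], Integrable (F n) Q :=
    fun n Q _ => Integrable.of_bound (hFm n).aestronglyMeasurable 1 (ae_of_all _ fun τ => by
      rw [Real.norm_eq_abs, abs_of_nonneg measureReal_nonneg]
      exact measureReal_le_one)
  have hF' : ∀ n (Q : Measure (List (Fin Δ) → Fin k)) [IsFiniteMeasure Q],
      Integrable (fun τ => |F n τ - p|) Q := fun n Q _ => ((hF n Q).sub (integrable_const p)).abs
  have hμ₁F : ∀ n, μ₁.real (ballCyl m η) = ∫ τ, F n τ ∂μ₁ := by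
    intro n
    rw [measureReal_def, hμ₁.2 (ballFinset Δ (m + n)) _ (measurableSet_ballCyl m η)]
    refine (integral_toReal ?_ ?_).symm
    · exact (measurable_uniformOn_extensions _ (measurableSet_ballCyl m η)).aemeasurable
    · exact ae_of_all _ fun τ => measure_lt_top _ _
  have hbound : ∀ n, a * |μ₁.real (ballCyl m η) - p| ≤
      2 * √((1 + rootInfo Δ k (n + 1)) ^ (level Δ m).card - 1) := by
    intro n
    have h1 : |μ₁.real (ballCyl m η) - p| ≤ ∫ τ, |F n τ - p| ∂μ₁ := by
      have : μ₁.real (ballCyl m η) - p = ∫ τ, (F n τ - p) ∂μ₁ := by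
        rw [integral_sub (hF n μ₁) (integrable_const p), ← hμ₁F]
        simp
      rw [this]
      exact abs_integral_le_integral_abs
    have h2 : ∫ τ, |F n τ - p| ∂P = a * ∫ τ, |F n τ - p| ∂μ₁ + b * ∫ τ, |F n τ - p| ∂μ₂ := by
      rw [← hab, integral_add_measure (hF' n _) (hF' n _), integral_smul_nnreal_measure,
        integral_smul_nnreal_measure]
      rfl
    have h3 : 0 ≤ (b : ℝ) * ∫ τ, |F n τ - p| ∂μ₂ :=
      mul_nonneg b.2 (integral_nonneg fun _ => abs_nonneg _)
    have h4 : ∫ τ, |F n τ - p| ∂P ≤ _ := integral_abs_uniformOn_extensions_sub_le m n η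
    have h5 : (a : ℝ) * |μ₁.real (ballCyl m η) - p| ≤ a * ∫ τ, |F n τ - p| ∂μ₁ :=
      mul_le_mul_of_nonneg_left h1 a.2
    linarith
  have hlim : Tendsto (fun n => 2 * √((1 + rootInfo Δ k (n + 1)) ^ (level Δ m).card - 1)) atTop
      (𝓝 0) := by
    have h1 : Tendsto (fun n => rootInfo Δ k (n + 1)) atTop (𝓝 0) :=
      h.comp (tendsto_add_atTop_nat 1)
    have h2 := ((((h1.const_add 1).pow (level Δ m).card).sub_const 1).sqrt).const_mul 2
    simpa using h2
  have h0 : a * |μ₁.real (ballCyl m η) - p| ≤ 0 := ge_of_tendsto' hlim hbound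
  have h1 : |μ₁.real (ballCyl m η) - p| = 0 := by
    have ha' : (0 : ℝ) < a := ha
    exact le_antisymm (nonpos_of_mul_nonpos_right h0 ha') (abs_nonneg _)
  rw [abs_eq_zero, sub_eq_zero, hp] at h1
  exact (measureReal_eq_measureReal_iff).1 h1

end Extremal

end TreeColoring

end

/-! ### The main theorem -/

open TreeColoring

theorem theorem1 :
    ∃ (α : ℝ → ℝ) (Δ₀ ℓ₀ : ℝ → ℕ),
      ∀ C : ℝ, 1 < C → ∀ ε : ℝ, ε = min (C - 1) (1 / 3) →
        0 < α ε ∧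
        ∀ Δ : ℕ, Δ₀ ε < Δ → ∀ k : ℕ, C * (Δ : ℝ) / Real.log (Δ : ℝ) < (k : ℝ) →
          (∀ c : Fin k, ∀ ℓ : ℕ, ℓ₀ ε < ℓ →
            TreeColoring.expectedBias Δ k ℓ c ≤ (Δ : ℝ) ^ (-(α ε) * (ℓ : ℝ))) ∧
          TreeColoring.NonReconstruction Δ k ∧
          (∃! μ : MeasureTheory.Measure (List (Fin Δ) → Fin k),
            TreeColoring.IsFreeBoundaryMeasure Δ k μ) ∧
          (∀ μ : MeasureTheory.Measure (List (Fin Δ) → Fin k),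
            TreeColoring.IsFreeBoundaryMeasure Δ k μ → TreeColoring.IsExtremalGibbs Δ k μ) := by
  have hex : ∀ ε : ℝ, ∃ N : ℕ, 0 < ε → ∀ Δ : ℕ, N < Δ → 2 ≤ Δ ∧ ∀ k : ℕ,
      (1 + ε) * Δ / Real.log Δ < k →
        2 ≤ k ∧ ∀ n : ℕ, rootInfo Δ k (n + 1) ≤ 4 * Δ * ((Δ : ℝ) ^ (-(1 / 2) : ℝ)) ^ n := by
    intro ε
    by_cases hε : 0 < ε
    · obtain ⟨N, hN⟩ := eventually_atTop.1 (eventually_rootInfo_le hε)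
      exact ⟨N, fun _ Δ hΔ => hN Δ hΔ.le⟩
    · exact ⟨0, fun h => absurd h hε⟩
  choose Δ₀ hΔ₀ using hex
  -- With ℓ = n + 1 the bias is at most Δ^(1/2 - n/4), the 2 from √4 being cancelled by k ≥ 2. The
  -- exponent is at most -(n + 1)/8 as soon as n ≥ 5.
  refine ⟨fun _ => 1 / 8, Δ₀, fun _ => 6, fun C hC ε hε => ⟨by norm_num, fun Δ hΔ k hk => ?_⟩⟩
  have hε0 : 0 < ε := by rw [hε]; exact lt_min (by linarith) (by norm_num)
  have hεC : 1 + ε ≤ C := by linarith [min_le_left (C - 1) (1 / 3)]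
  obtain ⟨hΔ2, hΔk⟩ := hΔ₀ ε hε0 Δ hΔ
  have hΔ2' : (2 : ℝ) ≤ Δ := by exact_mod_cast hΔ2
  have hΔ0 : (0 : ℝ) < Δ := by linarith
  have hlog : 0 < Real.log Δ := Real.log_pos (by linarith)
  obtain ⟨hk2, hinfo⟩ := hΔk k (lt_of_le_of_lt (by gcongr) hk)
  have : NeZero k := ⟨by omega⟩
  have : Nontrivial (Fin k) := Fin.nontrivial_iff_two_le.2 hk2
  have hk2' : (2 : ℝ) ≤ k := by exact_mod_cast hk2
  have hdecay : ∀ c : Fin k, ∀ ℓ : ℕ, 6 < ℓ →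
      expectedBias Δ k ℓ c ≤ (Δ : ℝ) ^ (-(1 / 8) * (ℓ : ℝ)) := by
    intro c ℓ hℓ
    obtain ⟨n, rfl⟩ : ∃ n, ℓ = n + 1 := ⟨ℓ - 1, by omega⟩
    have hn : (6 : ℝ) ≤ n := by exact_mod_cast Nat.lt_succ_iff.1 hℓ
    refine (expectedBias_le (n + 1) c).trans ?_
    have h1 : 4 * (Δ : ℝ) * ((Δ : ℝ) ^ (-(1 / 2) : ℝ)) ^ n =
        (2 * (Δ : ℝ) ^ (1 / 2 - n / 4 : ℝ)) ^ 2 := by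
      rw [mul_pow, ← Real.rpow_natCast, ← Real.rpow_natCast ((Δ : ℝ) ^ (1 / 2 - n / 4 : ℝ)),
        ← Real.rpow_mul hΔ0.le, ← Real.rpow_mul hΔ0.le, mul_assoc]
      nth_rewrite 1 [← Real.rpow_one (Δ : ℝ)]
      rw [← Real.rpow_add hΔ0]
      congr 2
      · norm_num
      · push_cast; ring
    have h2 : √(rootInfo Δ k (n + 1)) ≤ 2 * (Δ : ℝ) ^ (1 / 2 - n / 4 : ℝ) := by
      refine Real.sqrt_le_iff.2 ⟨by positivity, ?_⟩
      rw [← h1]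
      exact hinfo n
    calc √(rootInfo Δ k (n + 1)) / k ≤ (2 * (Δ : ℝ) ^ (1 / 2 - n / 4 : ℝ)) / 2 := by gcongr
      _ = (Δ : ℝ) ^ (1 / 2 - n / 4 : ℝ) := by ring
      _ ≤ _ := by
        refine Real.rpow_le_rpow_of_exponent_le (by linarith) ?_
        push_cast
        linarith
  refine ⟨hdecay, fun c => ?_, ⟨freeMeasure Δ k, isFreeBoundaryMeasure_freeMeasure,
    fun μ hμ => hμ.eq_freeMeasure⟩, fun μ hμ => ?_⟩
  · have hr : (Δ : ℝ) ^ (-(1 / 8) : ℝ) < 1 :=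
      Real.rpow_lt_one_of_one_lt_of_neg (by linarith) (by norm_num)
    have hpow : Tendsto (fun ℓ : ℕ => (Δ : ℝ) ^ (-(1 / 8) * (ℓ : ℝ))) atTop (𝓝 0) := by
      simp only [Real.rpow_mul hΔ0.le, Real.rpow_natCast]
      exact tendsto_pow_atTop_nhds_zero_of_lt_one (by positivity) hr
    refine squeeze_zero' (Eventually.of_forall fun ℓ => ?_) ?_ hpow
    · exact integral_nonneg fun _ => abs_nonneg _
    · filter_upwards [eventually_gt_atTop 6] with ℓ hℓ
      exact hdecay c ℓ hℓ
  · rw [hμ.eq_freeMeasure]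
    refine isExtremalGibbs_freeMeasure ?_
    rw [← tendsto_add_atTop_iff_nat 1]
    have hr : (Δ : ℝ) ^ (-(1 / 2) : ℝ) < 1 :=
      Real.rpow_lt_one_of_one_lt_of_neg (by linarith) (by norm_num)
    have hpow := (tendsto_pow_atTop_nhds_zero_of_lt_one
      (r := (Δ : ℝ) ^ (-(1 / 2) : ℝ)) (by positivity) hr).const_mul (4 * (Δ : ℝ))
    rw [mul_zero] at hpow
    exact squeeze_zero (fun n => rootInfo_nonneg hk2 _) hinfo hpow
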